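/- Let $n\ge 2$ and $s\in(0,1]$. For $h\in C_0^\infty(\mathbb{R}^n)$ put $$(-\Delta)^s h(x)=c_{s,n}\lim_{\varepsilon\to0^+}\int_{|x-y|>\varepsilon}\frac{h(x)-h(y)}{|x-y|^{n+2s}}\,dy\quad(0<s<1),\qquad (-\Delta)^1h=-\Delta h,$$ where $c_{s,n}=\dfrac{s\,4^s\,\Gamma(\frac n2+s)}{\pi^{n/2}\,\Gamma(1-s)}>0$. Let $u:(0,\infty)\to[-\infty,\infty)$ be upper semicontinuous with $$\int_0^\infty\frac{|u(r)|}{(1+r)^{n+2s}}\,r^{n-1}\,dr<\infty,$$ and suppose that for all $r>0$ and all $\tau\ge 1$ $$u(r)-u(r\tau)+\Big(u(r)-u\Big(\frac r\tau\Big)\Big)\tau^{-n+2s}\le 0$$ (this holds by convention when $u(r)=-\infty$, and fails when $u(r)$ is finite and $u(r\tau)$ or $u(r/\tau)$ is $-\infty$). Then the radial function $u(x)=u(|x|)$ is $s$-subharmonic in $\mathbb{R}^n\setminus\{0\}$. That is, $u$ is upper semicontinuous with values in $[-\infty,\infty)$ in $\mathbb{R}^n\setminus\{0\}$, it satisfies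 $$\int_{\mathbb{R}^n}\frac{|u(x)|}{(1+|x|^2)^{\frac{n+2s}{2}}}\,dx<\infty,$$ and $-(-\Delta)^s u\ge 0$ in the sense of distributions on $\mathbb{R}^n\setminus\{0\}$: for every $h\in C_0^\infty(\mathbb{R}^n\setminus\{0\})$ with $h\ge 0$ the integral below converges absolutely and $$-\langle(-\Delta)^su,h\rangle=-\int_{\mathbb{R}^n}u\,(-\Delta)^sh\,dx\ge 0 .$$ -/

import Mathlib

open MeasureTheory Filter Topology Set
open scoped ENNReal ContDiff

noncomputable section

/-- The normalization constant `c_{s,n} = s 4^s Γ(n/2 + s) / (π^{n/2} Γ(1 - s))` of the fractional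
Laplacian on `ℝⁿ`; it is positive for `0 < s < 1`, and makes `(-Δ)^s` the Fourier multiplier
with symbol `|ξ|^{2s}`. -/
def fracLaplacianConst (n : ℕ) (s : ℝ) : ℝ :=
  s * (4 : ℝ) ^ s * Real.Gamma ((n : ℝ) / 2 + s) / (Real.pi ^ ((n : ℝ) / 2) * Real.Gamma (1 - s))

/-- The truncated singular integral
`∫_{|x - y| > ε} (h(x) - h(y)) / |x - y|^{n + 2s} dy`. -/
def fracLaplacianTrunc {n : ℕ} (s : ℝ) (h : EuclideanSpace ℝ (Fin n) → ℝ)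
    (x : EuclideanSpace ℝ (Fin n)) (ε : ℝ) : ℝ :=
  ∫ y in {y : EuclideanSpace ℝ (Fin n) | ε < ‖x - y‖}, (h x - h y) / ‖x - y‖ ^ ((n : ℝ) + 2 * s)

/-- `(-Δ)^s h (x)` for `0 < s ≤ 1` and a smooth compactly supported function `h` on `ℝⁿ`:
the principal value `c_{s,n} lim_{ε → 0+} ∫_{|x - y| > ε} (h(x) - h(y)) / |x - y|^{n + 2s} dy`
when `0 < s < 1` (the limit exists for such `h`), and the classical `-Δ h (x)` when `s = 1`. -/
def fracLaplacian {n : ℕ} (s : ℝ) (h : EuclideanSpace ℝ (Fin n) → ℝ)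
    (x : EuclideanSpace ℝ (Fin n)) : ℝ :=
  if s = 1 then -(Laplacian.laplacian h x)
  else fracLaplacianConst n s * limUnder (𝓝[>] (0 : ℝ)) (fracLaplacianTrunc s h x)

/-- Test functions: `h ∈ C_0^∞(Ω)`, extended by zero to `ℝⁿ`. -/
structure IsTestFunctionOn {n : ℕ} (Ω : Set (EuclideanSpace ℝ (Fin n)))
    (h : EuclideanSpace ℝ (Fin n) → ℝ) : Prop where
  contDiff : ContDiff ℝ ∞ h
  hasCompactSupport : HasCompactSupport h
  tsupport_subset : tsupport h ⊆ Ω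

/-- `∫_{ℝⁿ} |u(x)| / (1 + |x|²)^{(n + 2s)/2} dx < ∞`, for a measurable extended real-valued `u`
(so `u` is finite almost everywhere). -/
structure HasWeightedIntegrability {n : ℕ} (s : ℝ) (u : EuclideanSpace ℝ (Fin n) → EReal) :
    Prop where
  aemeasurable : AEMeasurable u volume
  lintegral_lt_top :
    ∫⁻ x, (u x).abs / ENNReal.ofReal ((1 + ‖x‖ ^ 2) ^ (((n : ℝ) + 2 * s) / 2)) < ⊤

/-- The pairing `⟨(-Δ)^s u, h⟩ = ∫_{ℝⁿ} u (-Δ)^s h dx` that defines the distribution `(-Δ)^s u`.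
The set where `u` is infinite is null for the functions to which it is applied. -/
def fracLaplacianPairing {n : ℕ} (s : ℝ) (u : EuclideanSpace ℝ (Fin n) → EReal)
    (h : EuclideanSpace ℝ (Fin n) → ℝ) : ℝ :=
  ∫ x, (u x).toReal * fracLaplacian s h x

/-- `-(-Δ)^s u ≥ 0` in the sense of distributions in the open set `Ω`; the integral defining the
pairing is required to converge absolutely. -/
def NegFracLaplacianNonneg {n : ℕ} (s : ℝ) (u : EuclideanSpace ℝ (Fin n) → EReal)
    (Ω : Set (EuclideanSpace ℝ (Fin n))) : Prop :=
  ∀ h : EuclideanSpace ℝ (Fin n) → ℝ, IsTestFunctionOn Ω h → (∀ x, 0 ≤ h x) →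
    Integrable (fun x => (u x).toReal * fracLaplacian s h x) ∧ 0 ≤ -fracLaplacianPairing s u h

/-- `u` is `s`-subharmonic in the open set `Ω` (`0 < s ≤ 1`): `u` satisfies the weighted
integrability condition on `ℝⁿ`, `u : Ω → [-∞, ∞)` is upper semicontinuous in `Ω`, and
`-(-Δ)^s u ≥ 0` in `D'(Ω)`. -/
structure IsSSubharmonicOn {n : ℕ} (s : ℝ) (u : EuclideanSpace ℝ (Fin n) → EReal)
    (Ω : Set (EuclideanSpace ℝ (Fin n))) : Prop where
  integrability : HasWeightedIntegrability s u
  lt_top : ∀ x ∈ Ω, u x < ⊤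
  upperSemicontinuousOn : UpperSemicontinuousOn u Ω
  nonneg : NegFracLaplacianNonneg s u Ω

end

/-! The inequality is the pointwise form of "the fractional Laplacian of `u`, averaged with its
image under an inversion, is nonpositive". It first makes `u` finite on all of `(0, ∞)`: one finite
value propagates to every radius, and `u ≡ -∞` contradicts integrability. So `u` may be replaced by
a measurable real profile `v`, and what remains is the sign of the pairing with a test function `h ≥
0` supported away from the origin.

Case `s < 1`, with `p = n + 2s`. Cut the kernel `|x - y|^{-p}` off to `|x - y|² > ε²|x||y|`. This
truncation is symmetric, so Fubini turns `∫ v(|x|) ∫ (h(x) - h(y)) K` into `∫ h(x) ∫ (v(|x|) -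
v(|y|)) K`. It is also compatible with the inversion `y ↦ |x|²y/|y|²`: with `τ = |y|/|x|`, the
Jacobian `τ^{-2n}` times the kernel factor `τ^p` is `τ^{-n+2s}`. Averaging the inner integral over
this inversion gives half the integral of exactly the left side of the hypothesis at `r = |x|` times
a nonnegative kernel, so it is `≤ 0` (`integral_radial_sub_mul_truncKernel_nonpos`). As `ε → 0` the
truncation differs from a ball truncation only on a shell of volume `O(ε^{n+1})`, which costs
`O(ε^{2-2s})` (`exists_abs_integral_truncKernel_sub_le`). Everything is dominated by `(1 +
|x|)^{-p}`, against which `v` is integrable, so the sign passes to the principal value.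

Case `s = 1`. Write `|x|²Δ` as a second derivative along dilations plus half the sum of second
derivatives along coordinate rotations (`norm_sq_mul_laplacian`). Against the radial weight `v/|x|²`
the rotations contribute zero. For dilations, the factor `e^{ct}` with `c = (n-2)/2` produces the
radial part `(n-1) r∂_r + r²∂_r²` of `|x|²Δ`. The symmetric difference quotient at step `t` can be
moved from `h` onto `v`, where it is, up to a positive factor, minus the left side of the hypothesis
at `τ = e^t`. Hence no regularity of `v` is needed. -/

/-! ### Reduction to a real profile and its weighted integrability. -/

/-- If `a` is finite, `b, c < ⊤` and `a - b + (a - c) k ≤ 0` with `k > 0`, then `b` and `c` are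
finite. -/
theorem EReal.ne_bot_of_sub_add_sub_mul_nonpos {a b c : EReal} {k : ℝ} (hk : 0 < k)
    (ha : a ≠ ⊥) (ha' : a ≠ ⊤) (hb : b ≠ ⊤) (hc : c ≠ ⊤)
    (h : a - b + (a - c) * (k : EReal) ≤ 0) : b ≠ ⊥ ∧ c ≠ ⊥ := by
  lift a to ℝ using ⟨ha', ha⟩
  induction b with
  | top => exact absurd rfl hb
  | bot =>
    exfalso
    induction c with
    | top => exact absurd rfl hc
    | bot => simp [EReal.top_mul_coe_of_pos hk] at h
    | coe c =>
      rw [EReal.coe_sub_bot, ← EReal.coe_sub, ← EReal.coe_mul, EReal.top_add_coe] at h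
      simp at h
  | coe b =>
    refine ⟨EReal.coe_ne_bot b, ?_⟩
    rintro rfl
    rw [EReal.coe_sub_bot, EReal.top_mul_coe_of_pos hk, ← EReal.coe_sub, EReal.coe_add_top] at h
    simp at h

/-- An upper semicontinuous profile on `(0, ∞)` that is integrable and satisfies the inequality is
a measurable real function there. -/
theorem exists_real_profile {n : ℕ} {s : ℝ} {u : ℝ → EReal}
    (hu_lt_top : ∀ r : ℝ, 0 < r → u r < ⊤)
    (hu_usc : UpperSemicontinuousOn u (Ioi 0))
    (hu_int : ∫⁻ r in Ioi (0 : ℝ),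
      (u r).abs * ENNReal.ofReal (r ^ (n - 1) / (1 + r) ^ ((n : ℝ) + 2 * s)) < ⊤)
    (hu : ∀ r : ℝ, 0 < r → ∀ τ : ℝ, 1 ≤ τ →
      u r - u (r * τ) + (u r - u (r / τ)) * ((τ ^ (-(n : ℝ) + 2 * s) : ℝ) : EReal) ≤ 0) :
    ∃ v : ℝ → ℝ, Measurable v ∧ ∀ r, 0 < r → u r = (v r : EReal) := by
  have hbot : ∀ r, 0 < r → u r ≠ ⊥ := by
    by_cases hex : ∃ r₀, 0 < r₀ ∧ u r₀ ≠ ⊥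
    · obtain ⟨r₀, hr₀, hr₀'⟩ := hex
      -- One finite value suffices: every radius is `r₀ * τ` or `r₀ / τ` for some `τ ≥ 1`.
      have key : ∀ τ, 1 ≤ τ → u (r₀ * τ) ≠ ⊥ ∧ u (r₀ / τ) ≠ ⊥ := fun τ hτ =>
        EReal.ne_bot_of_sub_add_sub_mul_nonpos (by positivity) hr₀' (hu_lt_top r₀ hr₀).ne
          (hu_lt_top _ (by positivity)).ne (hu_lt_top _ (by positivity)).ne (hu r₀ hr₀ τ hτ)
      intro r hr
      rcases le_total r₀ r with hle | hle
      · have := (key (r / r₀) ((one_le_div hr₀).2 hle)).1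
        rwa [mul_div_cancel₀ _ hr₀.ne'] at this
      · have := (key (r₀ / r) ((one_le_div hr).2 hle)).2
        rwa [div_div_cancel₀ hr₀.ne'] at this
    · push Not at hex
      exfalso
      -- If `u` were `-∞` everywhere, the positive weight would make the integrand identically
      -- infinite.
      have h1 : ∫⁻ r in Ioi (0 : ℝ), (⊤ : ℝ≥0∞) ≤ ∫⁻ r in Ioi (0 : ℝ),
          (u r).abs * ENNReal.ofReal (r ^ (n - 1) / (1 + r) ^ ((n : ℝ) + 2 * s)) := by
        refine setLIntegral_mono' measurableSet_Ioi fun r hr => ?_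
        have hr' : 0 < r := hr
        rw [hex r hr, EReal.abs_bot, ENNReal.top_mul]
        rw [ENNReal.ofReal_ne_zero_iff]
        positivity
      rw [setLIntegral_const, Real.volume_Ioi, ENNReal.top_mul_top] at h1
      exact absurd hu_int (not_lt.2 h1)
  have hmeas : Measurable ((Ioi (0 : ℝ)).domRestrict u) :=
    (upperSemicontinuousOn_iff_restrict.2 hu_usc).measurable
  refine ⟨(Ioi (0 : ℝ)).indicator fun r => (u r).toReal, ?_, fun r hr => ?_⟩
  · refine measurable_of_restrict_of_restrict_compl (measurableSet_Ioi (a := (0 : ℝ))) ?_ ?_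
    · have : (Ioi (0 : ℝ)).domRestrict ((Ioi (0 : ℝ)).indicator fun r => (u r).toReal) =
          fun x => ((Ioi (0 : ℝ)).domRestrict u x).toReal := by
        ext x; simp
      rw [this]
      exact hmeas.ereal_toReal
    · have : (Ioi (0 : ℝ))ᶜ.domRestrict ((Ioi (0 : ℝ)).indicator fun r => (u r).toReal) =
          fun _ => 0 := by
        ext x; exact Set.indicator_of_notMem x.2 _
      rw [this]
      exact measurable_const
  · rw [Set.indicator_of_mem (show r ∈ Ioi (0 : ℝ) from hr),
      EReal.coe_toReal (hu_lt_top r hr).ne (hbot r hr)]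

/-- Radial form of the weighted integrability condition. -/
theorem integrable_radial_mul_one_add_norm {n : ℕ} (hn : 1 ≤ n) {s : ℝ} {v : ℝ → ℝ}
    (hv : Measurable v)
    (hint : ∫⁻ r in Ioi (0 : ℝ), ((v r : ℝ) : EReal).abs *
      ENNReal.ofReal (r ^ (n - 1) / (1 + r) ^ ((n : ℝ) + 2 * s)) < ⊤) :
    Integrable (fun x : EuclideanSpace ℝ (Fin n) =>
      v ‖x‖ * (1 + ‖x‖) ^ (-((n : ℝ) + 2 * s))) := by
  have : Nonempty (Fin n) := ⟨⟨0, hn⟩⟩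
  rw [integrable_fun_norm_addHaar volume (f := fun r => v r * (1 + r) ^ (-((n : ℝ) + 2 * s))),
    finrank_euclideanSpace_fin]
  refine ⟨by fun_prop, ?_⟩
  refine lt_of_le_of_lt (le_of_eq (setLIntegral_congr_fun measurableSet_Ioi fun r hr => ?_)) hint
  have hr' : 0 < r := hr
  have h1 : 0 < (1 + r) ^ ((n : ℝ) + 2 * s) := by positivity
  beta_reduce
  rw [EReal.abs_def, ← ENNReal.ofReal_mul (abs_nonneg _), ← ofReal_norm, smul_eq_mul,
    Real.norm_eq_abs, abs_mul, abs_mul, Real.rpow_neg (by positivity), abs_inv, abs_of_pos h1,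
    abs_of_pos (by positivity : 0 < r ^ (n - 1))]
  congr 1
  field_simp

theorem one_add_rpow_le_mul_one_add_sq_rpow {t p : ℝ} (ht : 0 ≤ t) (hp : 0 ≤ p) :
    (1 + t) ^ p ≤ 2 ^ (p / 2) * (1 + t ^ 2) ^ (p / 2) := by
  rw [← Real.mul_rpow (by positivity) (by positivity),
    show (1 + t) ^ p = ((1 + t) ^ 2) ^ (p / 2) by
      rw [← Real.rpow_natCast, ← Real.rpow_mul (by positivity)]; congr 1; push_cast; ring]
  exact Real.rpow_le_rpow (by positivity) (by nlinarith [sq_nonneg (t - 1)]) (by positivity)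

theorem hasWeightedIntegrability_of_integrable {n : ℕ} (hn : 1 ≤ n) {s : ℝ} (hs : 0 < s)
    {u : ℝ → EReal} {v : ℝ → ℝ} (hv : Measurable v) (huv : ∀ r, 0 < r → u r = (v r : EReal))
    (hint : Integrable (fun x : EuclideanSpace ℝ (Fin n) =>
      v ‖x‖ * (1 + ‖x‖) ^ (-((n : ℝ) + 2 * s)))) :
    HasWeightedIntegrability s (fun x : EuclideanSpace ℝ (Fin n) => u ‖x‖) := by
  have : Nonempty (Fin n) := ⟨⟨0, hn⟩⟩
  have hae : ∀ᵐ x : EuclideanSpace ℝ (Fin n), u ‖x‖ = (v ‖x‖ : EReal) := by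
    filter_upwards [compl_mem_ae_iff.2 (measure_singleton (0 : EuclideanSpace ℝ (Fin n)))]
      with x hx
    exact huv _ (norm_pos_iff.2 hx)
  refine ⟨⟨fun x => (v ‖x‖ : EReal), by fun_prop, hae⟩, ?_⟩
  set p : ℝ := (n : ℝ) + 2 * s with hp
  have hp0 : 0 < p := by positivity
  have h2 := (hint.const_mul (2 ^ (p / 2))).2
  refine lt_of_le_of_lt (lintegral_mono_ae ?_) h2
  filter_upwards [hae] with x hx
  have h1 := one_add_rpow_le_mul_one_add_sq_rpow (norm_nonneg x) hp0.le
  rw [hx, EReal.abs_def, ← ENNReal.ofReal_div_of_pos (by positivity), ← ofReal_norm]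
  refine ENNReal.ofReal_le_ofReal ?_
  rw [Real.norm_eq_abs, abs_mul, abs_mul, Real.rpow_neg (by positivity), abs_inv,
    abs_of_pos (by positivity : 0 < (1 + ‖x‖) ^ p),
    abs_of_pos (by positivity : (0 : ℝ) < 2 ^ (p / 2)), div_le_iff₀ (by positivity)]
  calc |v ‖x‖| = |v ‖x‖| * ((1 + ‖x‖) ^ p)⁻¹ * (1 + ‖x‖) ^ p := by field_simp
    _ ≤ |v ‖x‖| * ((1 + ‖x‖) ^ p)⁻¹ * (2 ^ (p / 2) * (1 + ‖x‖ ^ 2) ^ (p / 2)) := by gcongr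
    _ = _ := by ring

/-- A function bounded by `C (1 + |x|)^{-p}` may be integrated against the radial profile. -/
theorem integrable_radial_mul_of_le {n : ℕ} {p C : ℝ} {v : ℝ → ℝ} (hv : Measurable v)
    (hint : Integrable (fun x : EuclideanSpace ℝ (Fin n) => v ‖x‖ * (1 + ‖x‖) ^ (-p)))
    {g : EuclideanSpace ℝ (Fin n) → ℝ} (hg : AEStronglyMeasurable g volume)
    (hgC : ∀ᵐ x, |g x| ≤ C * (1 + ‖x‖) ^ (-p)) :
    Integrable (fun x => v ‖x‖ * g x) := by
  refine (hint.norm.const_mul C).mono' ((by fun_prop : Measurable fun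
    x : EuclideanSpace ℝ (Fin n) => v ‖x‖).aestronglyMeasurable.mul hg) ?_
  filter_upwards [hgC] with x hx
  rw [norm_mul, norm_mul, Real.norm_of_nonneg (by positivity : 0 ≤ (1 + ‖x‖) ^ (-p))]
  calc ‖v ‖x‖‖ * ‖g x‖ ≤ ‖v ‖x‖‖ * (C * (1 + ‖x‖) ^ (-p)) := by gcongr; exact hx
    _ = _ := by ring

/-! ### The inversion-invariant truncated kernel. -/

/-- The kernel `|x - y|^{-p}` truncated to the region `|x - y|² > ε² |x| |y|`, which is symmetric
and invariant under the inversion `y ↦ |x|² y / |y|²`. -/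
noncomputable def truncKernel {n : ℕ} (p ε : ℝ) (x y : EuclideanSpace ℝ (Fin n)) : ℝ :=
  if ε ^ 2 * (‖x‖ * ‖y‖) < ‖x - y‖ ^ 2 then ‖x - y‖ ^ (-p) else 0

namespace truncKernel

variable {n : ℕ} {p ε : ℝ}

theorem symm (x y : EuclideanSpace ℝ (Fin n)) : truncKernel p ε x y = truncKernel p ε y x := by
  rw [truncKernel, truncKernel, norm_sub_rev, mul_comm ‖x‖]

theorem nonneg (x y : EuclideanSpace ℝ (Fin n)) : 0 ≤ truncKernel p ε x y := by
  rw [truncKernel]; positivity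

theorem measurable_uncurry : Measurable fun z : EuclideanSpace ℝ (Fin n) ×
    EuclideanSpace ℝ (Fin n) => truncKernel p ε z.1 z.2 := by
  unfold truncKernel
  exact Measurable.ite (measurableSet_lt (by fun_prop) (by fun_prop)) (by fun_prop) (by fun_prop)

theorem measurable_right (x : EuclideanSpace ℝ (Fin n)) : Measurable fun y => truncKernel p ε x y := by
  unfold truncKernel
  exact Measurable.ite (measurableSet_lt (by fun_prop) (by fun_prop)) (by fun_prop) (by fun_prop)

/-- Where the kernel is nonzero, `(|x| + |y|)² = (|x| - |y|)² + 4|x||y|` is at most `(1 + 4/ε²)|x -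
y|²`. -/
theorem le_add_norm_rpow (hε : 0 < ε) (hp : 0 < p) (x y : EuclideanSpace ℝ (Fin n)) :
    truncKernel p ε x y ≤ √(1 + 4 / ε ^ 2) ^ p * (‖x‖ + ‖y‖) ^ (-p) := by
  rw [truncKernel]
  split_ifs with h
  · have hd : 0 < ‖x - y‖ := by
      by_contra hd
      have : ‖x - y‖ = 0 := le_antisymm (not_lt.1 hd) (norm_nonneg _)
      rw [this] at h
      have : 0 ≤ ε ^ 2 * (‖x‖ * ‖y‖) := by positivity
      norm_num at h
      linarith
    have ha : 0 < ‖x‖ + ‖y‖ := hd.trans_le (norm_sub_le _ _)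
    have h1 : ‖x‖ * ‖y‖ ≤ ‖x - y‖ ^ 2 / ε ^ 2 := by
      rw [le_div_iff₀ (by positivity)]; linarith
    have h2 : (‖x‖ - ‖y‖) ^ 2 ≤ ‖x - y‖ ^ 2 := sq_le_sq' (by
      linarith [abs_le.1 (abs_norm_sub_norm_le x y)]) (abs_le.1 (abs_norm_sub_norm_le x y)).2
    have h3 : ‖x‖ + ‖y‖ ≤ √(1 + 4 / ε ^ 2) * ‖x - y‖ := by
      refine le_of_sq_le_sq ?_ (by positivity)
      rw [mul_pow, Real.sq_sqrt (by positivity)]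
      calc (‖x‖ + ‖y‖) ^ 2 = (‖x‖ - ‖y‖) ^ 2 + 4 * (‖x‖ * ‖y‖) := by ring
        _ ≤ ‖x - y‖ ^ 2 + 4 * (‖x - y‖ ^ 2 / ε ^ 2) := by gcongr
        _ = _ := by ring
    calc ‖x - y‖ ^ (-p) = √(1 + 4 / ε ^ 2) ^ p * (√(1 + 4 / ε ^ 2) * ‖x - y‖) ^ (-p) := by
          rw [Real.mul_rpow (by positivity) hd.le, ← mul_assoc, ← Real.rpow_add (by positivity)]
          simp
      _ ≤ _ := by
          gcongr ?_ * ?_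
          exact Real.rpow_le_rpow_of_nonpos ha h3 (by linarith)
  · positivity

/-- For `|y| ≥ ρ` one has `|x| + |y| ≥ min(1, ρ)(1 + |x|)`. The bound is integrable in `x` and
uniform in such `y`. -/
theorem le_one_add_norm_rpow (hε : 0 < ε) (hp : 0 < p) {ρ : ℝ} (hρ : 0 < ρ) :
    ∃ C, 0 ≤ C ∧ ∀ x y : EuclideanSpace ℝ (Fin n), ρ ≤ ‖y‖ →
      truncKernel p ε x y ≤ C * (1 + ‖x‖) ^ (-p) := by
  have hm : 0 < min 1 ρ := by positivity
  refine ⟨√(1 + 4 / ε ^ 2) ^ p * (min 1 ρ) ^ (-p), by positivity, fun x y hy => ?_⟩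
  refine (le_add_norm_rpow hε hp x y).trans ?_
  rw [mul_assoc, ← Real.mul_rpow hm.le (by positivity)]
  gcongr ?_ * ?_
  refine Real.rpow_le_rpow_of_nonpos (by positivity) ?_ (by linarith)
  have h1 : min 1 ρ ≤ ρ := min_le_right _ _
  have h2 : min 1 ρ * ‖x‖ ≤ 1 * ‖x‖ := by gcongr; exact min_le_left _ _
  linarith

/-- The inversion of radius `|x|` fixes `x` and multiplies `|x - y|` by `|x|/|y|`. Both sides of the
truncation condition scale by `(|x|/|y|)²`, so the condition itself is unchanged. -/
theorem inversion {x y : EuclideanSpace ℝ (Fin n)} (hx : x ≠ 0) (hy : y ≠ 0) :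
    truncKernel p ε x (EuclideanGeometry.inversion 0 ‖x‖ y) =
      (‖y‖ / ‖x‖) ^ p * truncKernel p ε x y := by
  have hx' : 0 < ‖x‖ := norm_pos_iff.2 hx
  have hy' : 0 < ‖y‖ := norm_pos_iff.2 hy
  have h1 : ‖EuclideanGeometry.inversion 0 ‖x‖ y‖ = ‖x‖ ^ 2 / ‖y‖ := by
    simpa using EuclideanGeometry.dist_inversion_center 0 y ‖x‖
  have h2 : ‖x - EuclideanGeometry.inversion 0 ‖x‖ y‖ = ‖x‖ / ‖y‖ * ‖x - y‖ := by
    have h3 := EuclideanGeometry.dist_inversion_inversion hx hy ‖x‖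
    rw [EuclideanGeometry.inversion_of_mem_sphere (by simp), dist_zero_right, dist_zero_right,
      dist_eq_norm, dist_eq_norm] at h3
    rw [h3]; field_simp
  rw [truncKernel, truncKernel, h1, h2]
  have h4 : ε ^ 2 * (‖x‖ * (‖x‖ ^ 2 / ‖y‖)) < (‖x‖ / ‖y‖ * ‖x - y‖) ^ 2 ↔
      ε ^ 2 * (‖x‖ * ‖y‖) < ‖x - y‖ ^ 2 := by
    rw [← mul_lt_mul_iff_right₀ (show 0 < (‖x‖ / ‖y‖) ^ 2 by positivity)
      (b := ε ^ 2 * (‖x‖ * ‖y‖))]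
    have : (‖x‖ / ‖y‖) ^ 2 * (ε ^ 2 * (‖x‖ * ‖y‖)) = ε ^ 2 * (‖x‖ * (‖x‖ ^ 2 / ‖y‖)) := by
      field_simp
    rw [this, mul_pow]
  simp only [h4]
  split_ifs
  · rw [Real.mul_rpow (by positivity) (by positivity), Real.rpow_neg (by positivity),
      ← Real.inv_rpow (by positivity), inv_div]
  · simp

end truncKernel

/-! ### Change of variables by inversion and the sign of the truncated pairing. -/

/-- The derivative of an inversion is a reflection, of determinant `±1`, scaled by `(R/|y|)²`. -/
theorem abs_det_fderiv_inversion {n : ℕ} (R : ℝ) (y : EuclideanSpace ℝ (Fin n)) :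
    |((R / dist y 0) ^ 2 • ((ℝ ∙ (y - 0))ᗮ.reflection :
      EuclideanSpace ℝ (Fin n) →L[ℝ] EuclideanSpace ℝ (Fin n))).det| = (R / ‖y‖) ^ (2 * n) := by
  rw [ContinuousLinearMap.det, ContinuousLinearMap.toLinearMap_smul, LinearMap.det_smul,
    finrank_euclideanSpace_fin, abs_mul, dist_zero_right]
  have := (ℝ ∙ (y - 0))ᗮ.det_reflection
  have h1 : |LinearMap.det ((ℝ ∙ (y - 0))ᗮ.reflection.toLinearMap)| = 1 := by
    rw [this, abs_pow, abs_neg, abs_one, one_pow]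
  have h2 : (((ℝ ∙ (y - 0))ᗮ.reflection : EuclideanSpace ℝ (Fin n) →L[ℝ] EuclideanSpace ℝ (Fin n)) :
    EuclideanSpace ℝ (Fin n) →ₗ[ℝ] EuclideanSpace ℝ (Fin n)) = (ℝ ∙ (y - 0))ᗮ.reflection.toLinearMap := rfl
  rw [h2, h1, mul_one, ← pow_mul, abs_of_nonneg (by rw [pow_mul]; positivity)]

theorem image_inversion_compl_singleton {n : ℕ} {R : ℝ} (hR : R ≠ 0) :
    EuclideanGeometry.inversion (0 : EuclideanSpace ℝ (Fin n)) R '' {0}ᶜ = {0}ᶜ := by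
  ext y
  constructor
  · rintro ⟨z, hz, rfl⟩
    exact fun h => hz ((EuclideanGeometry.inversion_eq_center hR).1 h)
  · intro hy
    exact ⟨EuclideanGeometry.inversion 0 R y,
      fun h => hy ((EuclideanGeometry.inversion_eq_center hR).1 h),
      EuclideanGeometry.inversion_inversion 0 hR y⟩

/-- Change of variables under an inversion centered at the origin. -/
theorem integral_comp_inversion {n : ℕ} (hn : 1 ≤ n) {R : ℝ} (hR : R ≠ 0)
    (f : EuclideanSpace ℝ (Fin n) → ℝ) :
    ∫ y, (R / ‖y‖) ^ (2 * n) * f (EuclideanGeometry.inversion 0 R y) = ∫ y, f y := by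
  have : Nonempty (Fin n) := ⟨⟨0, hn⟩⟩
  have h := integral_image_eq_integral_abs_det_fderiv_smul volume
    (measurableSet_singleton (0 : EuclideanSpace ℝ (Fin n))).compl
    (fun y hy => (EuclideanGeometry.hasFDerivAt_inversion (R := R) hy).hasFDerivWithinAt)
    (EuclideanGeometry.inversion_injective 0 hR).injOn f
  simp_rw [abs_det_fderiv_inversion] at h
  rw [image_inversion_compl_singleton hR] at h
  simpa only [restrict_compl_singleton, smul_eq_mul] using h.symm

theorem integrable_comp_inversion {n : ℕ} (hn : 1 ≤ n) {R : ℝ} (hR : R ≠ 0)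
    {f : EuclideanSpace ℝ (Fin n) → ℝ} (hf : Integrable f) :
    Integrable fun y => (R / ‖y‖) ^ (2 * n) * f (EuclideanGeometry.inversion 0 R y) := by
  have : Nonempty (Fin n) := ⟨⟨0, hn⟩⟩
  have h := integrableOn_image_iff_integrableOn_abs_det_fderiv_smul volume
    (measurableSet_singleton (0 : EuclideanSpace ℝ (Fin n))).compl
    (fun y hy => (EuclideanGeometry.hasFDerivAt_inversion (R := R) hy).hasFDerivWithinAt)
    (EuclideanGeometry.inversion_injective 0 hR).injOn f
  simp_rw [abs_det_fderiv_inversion] at h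
  rw [image_inversion_compl_singleton hR] at h
  simp only [IntegrableOn, restrict_compl_singleton, smul_eq_mul] at h
  exact h.1 hf

/-- This is where the hypothesis enters for `s < 1`: averaging over the inversion of radius `|x|`
pairs the radii `|x|τ` and `|x|/τ`, and the sum is pointwise nonpositive. -/
theorem integral_radial_sub_mul_truncKernel_nonpos {n : ℕ} (hn : 1 ≤ n) {s ε : ℝ} (hs : 0 < s)
    (hε : 0 < ε) {v : ℝ → ℝ} (hv : Measurable v)
    (hint : Integrable (fun x : EuclideanSpace ℝ (Fin n) =>
      v ‖x‖ * (1 + ‖x‖) ^ (-((n : ℝ) + 2 * s))))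
    (hineq : ∀ r : ℝ, 0 < r → ∀ τ : ℝ, 1 ≤ τ →
      v r - v (r * τ) + (v r - v (r / τ)) * τ ^ (-(n : ℝ) + 2 * s) ≤ 0)
    {x : EuclideanSpace ℝ (Fin n)} (hx : x ≠ 0) :
    ∫ y, (v ‖x‖ - v ‖y‖) * truncKernel ((n : ℝ) + 2 * s) ε x y ≤ 0 := by
  have : Nonempty (Fin n) := ⟨⟨0, hn⟩⟩
  set p : ℝ := (n : ℝ) + 2 * s with hp
  have hp0 : 0 < p := by positivity
  have hx' : 0 < ‖x‖ := norm_pos_iff.2 hx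
  set f : EuclideanSpace ℝ (Fin n) → ℝ :=
    fun y => (v ‖x‖ - v ‖y‖) * truncKernel p ε x y with hf
  have hfi : Integrable f := by
    obtain ⟨C, hC, hCK⟩ := truncKernel.le_one_add_norm_rpow (n := n) hε hp0 hx'
    have hK : ∀ y, |truncKernel p ε x y| ≤ C * (1 + ‖y‖) ^ (-p) := fun y => by
      rw [abs_of_nonneg (truncKernel.nonneg _ _), truncKernel.symm]
      exact hCK y x le_rfl
    have h1 : Integrable fun y => truncKernel p ε x y := by
      refine ((integrable_one_add_norm (μ := volume) (E := EuclideanSpace ℝ (Fin n))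
        (r := p) ?_).const_mul C).mono'
        (truncKernel.measurable_right x).aestronglyMeasurable (.of_forall hK)
      rw [finrank_euclideanSpace_fin]; linarith
    have h2 := integrable_radial_mul_of_le hv hint (g := fun y => truncKernel p ε x y)
      (truncKernel.measurable_right x).aestronglyMeasurable (.of_forall hK)
    refine ((h1.const_mul (v ‖x‖)).sub h2).congr (.of_forall fun y => ?_)
    simp only [hf, Pi.sub_apply]; ring
  have hI : 2 * ∫ y, f y = ∫ y, (f y + (‖x‖ / ‖y‖) ^ (2 * n) *
      f (EuclideanGeometry.inversion 0 ‖x‖ y)) := by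
    rw [integral_add hfi (integrable_comp_inversion hn hx'.ne' hfi),
      integral_comp_inversion hn hx'.ne']
    ring
  suffices h : ∫ y, (f y + (‖x‖ / ‖y‖) ^ (2 * n) *
      f (EuclideanGeometry.inversion 0 ‖x‖ y)) ≤ 0 by linarith
  refine integral_nonpos_of_ae ?_
  filter_upwards [compl_mem_ae_iff.2 (measure_singleton (0 : EuclideanSpace ℝ (Fin n)))] with y hy
  have hy' : 0 < ‖y‖ := norm_pos_iff.2 hy
  have h1 : ‖EuclideanGeometry.inversion 0 ‖x‖ y‖ = ‖x‖ ^ 2 / ‖y‖ := by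
    simpa using EuclideanGeometry.dist_inversion_center 0 y ‖x‖
  -- Jacobian times kernel factor: `-2n + (n + 2s)` is the exponent in the hypothesis.
  have h2 : (‖x‖ / ‖y‖) ^ (2 * n) * (‖y‖ / ‖x‖) ^ p = (‖y‖ / ‖x‖) ^ (-(n : ℝ) + 2 * s) := by
    rw [show ‖x‖ / ‖y‖ = (‖y‖ / ‖x‖)⁻¹ by simp, inv_pow, ← Real.rpow_natCast,
      ← Real.rpow_neg (by positivity), ← Real.rpow_add (by positivity)]
    congr 1; push_cast; ring
  have h3 : f y + (‖x‖ / ‖y‖) ^ (2 * n) * f (EuclideanGeometry.inversion 0 ‖x‖ y) =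
      (v ‖x‖ - v ‖y‖ + (v ‖x‖ - v (‖x‖ ^ 2 / ‖y‖)) * (‖y‖ / ‖x‖) ^ (-(n : ℝ) + 2 * s)) *
        truncKernel p ε x y := by
    simp only [hf]
    rw [truncKernel.inversion hx hy, h1, ← h2]
    ring
  rw [h3]
  refine mul_nonpos_of_nonpos_of_nonneg ?_ (truncKernel.nonneg _ _)
  rcases le_total ‖x‖ ‖y‖ with hle | hle
  · have := hineq ‖x‖ hx' (‖y‖ / ‖x‖) ((one_le_div hx').2 hle)
    rwa [mul_div_cancel₀ _ hx'.ne', div_div_eq_mul_div, ← sq] at this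
  -- For `|y| ≤ |x|` use `τ = |x|/|y|`; multiplying by `τ^{n-2s}` exchanges the roles of the two
  -- differences.
  · have := hineq ‖x‖ hx' (‖x‖ / ‖y‖) ((one_le_div hy').2 hle)
    rw [div_div_cancel₀ hx'.ne', ← mul_div_assoc, ← sq] at this
    have h4 : (‖x‖ / ‖y‖) ^ (-(n : ℝ) + 2 * s) * (‖y‖ / ‖x‖) ^ (-(n : ℝ) + 2 * s) = 1 := by
      rw [← Real.mul_rpow (by positivity) (by positivity),
        show ‖x‖ / ‖y‖ * (‖y‖ / ‖x‖) = 1 by field_simp, Real.one_rpow]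
    have h5 : 0 < (‖y‖ / ‖x‖) ^ (-(n : ℝ) + 2 * s) := by positivity
    have h6 := mul_nonpos_of_nonpos_of_nonneg this h5.le
    rw [add_mul, mul_assoc, h4] at h6
    linarith

theorem exists_abs_le_one_add_norm_rpow {n : ℕ} (p : ℝ) {h : EuclideanSpace ℝ (Fin n) → ℝ}
    (hc : Continuous h) (hsupp : HasCompactSupport h) :
    ∃ C, 0 ≤ C ∧ ∀ x, |h x| ≤ C * (1 + ‖x‖) ^ (-p) := by
  have hcont : Continuous fun x => (1 + ‖x‖) ^ p * h x :=
    (Continuous.rpow_const (by fun_prop) fun x => Or.inl (by positivity)).mul hc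
  obtain ⟨C, hC⟩ := hcont.bounded_above_of_compact_support hsupp.mul_left
  refine ⟨C, (norm_nonneg _).trans (hC 0), fun x => ?_⟩
  have h1 := hC x
  rw [norm_mul, Real.norm_of_nonneg (by positivity), Real.norm_eq_abs] at h1
  rw [Real.rpow_neg (by positivity), ← div_eq_mul_inv, le_div_iff₀ (by positivity)]
  linarith

/-- The truncated fractional Laplacian of a nonnegative function pairs with the profile to a
nonpositive number. -/
theorem integral_radial_mul_truncKernel_nonpos {n : ℕ} (hn : 1 ≤ n) {s ε : ℝ} (hs : 0 < s)
    (hε : 0 < ε) {v : ℝ → ℝ} (hv : Measurable v)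
    (hint : Integrable (fun x : EuclideanSpace ℝ (Fin n) =>
      v ‖x‖ * (1 + ‖x‖) ^ (-((n : ℝ) + 2 * s))))
    (hineq : ∀ r : ℝ, 0 < r → ∀ τ : ℝ, 1 ≤ τ →
      v r - v (r * τ) + (v r - v (r / τ)) * τ ^ (-(n : ℝ) + 2 * s) ≤ 0)
    {h : EuclideanSpace ℝ (Fin n) → ℝ} (hc : Continuous h) (hsupp : HasCompactSupport h)
    {ρ : ℝ} (hρ : 0 < ρ) (hρh : ∀ x, h x ≠ 0 → ρ ≤ ‖x‖) (h0 : ∀ x, 0 ≤ h x) :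
    ∫ x, v ‖x‖ * ∫ y, (h x - h y) * truncKernel ((n : ℝ) + 2 * s) ε x y ≤ 0 := by
  set p : ℝ := (n : ℝ) + 2 * s with hp
  have hp0 : 0 < p := by positivity
  obtain ⟨C, hC, hCK⟩ := truncKernel.le_one_add_norm_rpow (n := n) hε hp0 hρ
  obtain ⟨C', -, hC'⟩ := exists_abs_le_one_add_norm_rpow p hc hsupp
  have hvh : Integrable fun x => v ‖x‖ * h x :=
    integrable_radial_mul_of_le hv hint hc.aestronglyMeasurable (.of_forall hC')
  have hone : Integrable fun x : EuclideanSpace ℝ (Fin n) => (1 + ‖x‖) ^ (-p) :=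
    integrable_one_add_norm (by rw [finrank_euclideanSpace_fin]; linarith)
  have hmh : Measurable h := hc.measurable
  have hmK := truncKernel.measurable_uncurry (n := n) (p := p) (ε := ε)
  -- The truncation makes the two halves of the difference separately integrable on the product: `h`
  -- keeps one variable at distance `ρ` from the origin, so the kernel decays in the other.
  have hF₁ : Integrable (fun z : EuclideanSpace ℝ (Fin n) × EuclideanSpace ℝ (Fin n) =>
      v ‖z.1‖ * h z.1 * truncKernel p ε z.1 z.2) (volume.prod volume) := by
    refine ((hvh.norm.mul_prod hone).const_mul C).mono'
      (((by fun_prop : Measurable fun z : EuclideanSpace ℝ (Fin n) × EuclideanSpace ℝ (Fin n) =>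
        v ‖z.1‖ * h z.1).mul hmK).aestronglyMeasurable) (.of_forall fun z => ?_)
    by_cases hz : h z.1 = 0
    · simp [hz]
    · rw [norm_mul, Real.norm_of_nonneg (truncKernel.nonneg _ _), truncKernel.symm]
      calc _ ≤ ‖v ‖z.1‖ * h z.1‖ * (C * (1 + ‖z.2‖) ^ (-p)) := by
            gcongr; exact hCK _ _ (hρh _ hz)
        _ = _ := by ring
  have hF₂ : Integrable (fun z : EuclideanSpace ℝ (Fin n) × EuclideanSpace ℝ (Fin n) =>
      v ‖z.1‖ * h z.2 * truncKernel p ε z.1 z.2) (volume.prod volume) := by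
    refine ((hint.norm.mul_prod (hc.integrable_of_hasCompactSupport hsupp).norm).const_mul C).mono'
      (((by fun_prop : Measurable fun z : EuclideanSpace ℝ (Fin n) × EuclideanSpace ℝ (Fin n) =>
        v ‖z.1‖ * h z.2).mul hmK).aestronglyMeasurable) (.of_forall fun z => ?_)
    by_cases hz : h z.2 = 0
    · simp [hz]
    · rw [norm_mul, norm_mul, norm_mul, Real.norm_of_nonneg (truncKernel.nonneg _ _),
        Real.norm_of_nonneg (by positivity : 0 ≤ (1 + ‖z.1‖) ^ (-p))]
      calc _ ≤ ‖v ‖z.1‖‖ * ‖h z.2‖ * (C * (1 + ‖z.1‖) ^ (-p)) := by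
            gcongr; exact hCK _ _ (hρh _ hz)
        _ = _ := by ring
  have hF₂' : Integrable (fun z : EuclideanSpace ℝ (Fin n) × EuclideanSpace ℝ (Fin n) =>
      v ‖z.2‖ * h z.1 * truncKernel p ε z.2 z.1) (volume.prod volume) := hF₂.swap
  have hd : Integrable (fun z : EuclideanSpace ℝ (Fin n) × EuclideanSpace ℝ (Fin n) =>
      v ‖z.1‖ * h z.1 * truncKernel p ε z.1 z.2 - v ‖z.1‖ * h z.2 * truncKernel p ε z.1 z.2)
      (volume.prod volume) := hF₁.sub hF₂
  have hd' : Integrable (fun z : EuclideanSpace ℝ (Fin n) × EuclideanSpace ℝ (Fin n) =>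
      v ‖z.1‖ * h z.1 * truncKernel p ε z.1 z.2 - v ‖z.2‖ * h z.1 * truncKernel p ε z.2 z.1)
      (volume.prod volume) := hF₁.sub hF₂'
  have hswap : ∫ z : EuclideanSpace ℝ (Fin n) × EuclideanSpace ℝ (Fin n),
      v ‖z.2‖ * h z.1 * truncKernel p ε z.2 z.1 ∂(volume.prod volume) =
      ∫ z, v ‖z.1‖ * h z.2 * truncKernel p ε z.1 z.2 ∂(volume.prod volume) :=
    integral_prod_swap (fun z : EuclideanSpace ℝ (Fin n) × EuclideanSpace ℝ (Fin n) =>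
      v ‖z.1‖ * h z.2 * truncKernel p ε z.1 z.2)
  have e1 : ∫ x, v ‖x‖ * ∫ y, (h x - h y) * truncKernel p ε x y =
      ∫ z, (v ‖z.1‖ * h z.1 * truncKernel p ε z.1 z.2 -
        v ‖z.1‖ * h z.2 * truncKernel p ε z.1 z.2) ∂(volume.prod volume) := by
    rw [integral_prod _ hd]
    refine integral_congr_ae (.of_forall fun x => ?_)
    beta_reduce
    rw [← integral_const_mul]
    exact integral_congr_ae (.of_forall fun y => by simp only; ring)
  -- Exchanging the variables in the second half and using the symmetry of the kernel moves the
  -- difference from `h` to `v`.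
  have e2 : ∫ z, (v ‖z.1‖ * h z.1 * truncKernel p ε z.1 z.2 -
        v ‖z.1‖ * h z.2 * truncKernel p ε z.1 z.2) ∂(volume.prod volume) =
      ∫ x, h x * ∫ y, (v ‖x‖ - v ‖y‖) * truncKernel p ε x y := by
    rw [integral_sub hF₁ hF₂, ← hswap, ← integral_sub hF₁ hF₂', integral_prod _ hd']
    refine integral_congr_ae (.of_forall fun x => ?_)
    beta_reduce
    rw [← integral_const_mul]
    refine integral_congr_ae (.of_forall fun y => ?_)
    simp only
    rw [truncKernel.symm y x]
    ring
  rw [e1, e2]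
  refine integral_nonpos fun x => ?_
  by_cases hx : h x = 0
  · simp [hx]
  · exact mul_nonpos_of_nonneg_of_nonpos (h0 x) (integral_radial_sub_mul_truncKernel_nonpos hn hs
      hε hv hint hineq (norm_pos_iff.1 (hρ.trans_le (hρh x hx))))

/-! ### The principal value: symmetric second differences, existence and decay. -/

/-- First-order Taylor expansions at `±z` have opposite linear terms, and the derivative is
Lipschitz; for large `z` boundedness of `h` is better. -/
theorem exists_abs_second_difference_le {E : Type*} [NormedAddCommGroup E] [NormedSpace ℝ E]
    {h : E → ℝ} (hh : ContDiff ℝ ∞ h) (hsupp : HasCompactSupport h) :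
    ∃ M, 0 ≤ M ∧ ∀ x z, |2 * h x - h (x + z) - h (x - z)| ≤ M * min 1 (‖z‖ ^ 2) := by
  obtain ⟨A, hA⟩ := hh.continuous.bounded_above_of_compact_support hsupp
  obtain ⟨L, hL⟩ := ContDiff.lipschitzWith_of_hasCompactSupport (hsupp.fderiv ℝ)
    (hh.fderiv_right (m := ∞) (by simp)) (by simp)
  have hA0 : 0 ≤ A := by
    simpa using (norm_nonneg _).trans (hA 0)
  have hT : ∀ x z, |h (x + z) - h x - fderiv ℝ h x z| ≤ L * ‖z‖ ^ 2 := by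
    intro x z
    have := (convex_closedBall x ‖z‖).norm_image_sub_le_of_norm_fderiv_le' (𝕜 := ℝ) (f := h)
      (C := L * ‖z‖) (φ := fderiv ℝ h x) (x := x) (y := x + z)
      (fun y _ => hh.contDiffAt.differentiableAt (by simp))
      (fun y hy => by
        refine (hL.norm_sub_le y x).trans ?_
        gcongr
        simpa [dist_eq_norm] using hy) (by simp) (by simp)
    rw [add_sub_cancel_left, Real.norm_eq_abs] at this
    linarith [this]
  refine ⟨max (4 * A) (2 * L), by positivity, fun x z => ?_⟩
  rw [mul_min_of_nonneg _ _ (by positivity), mul_one]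
  have e1 := abs_le.1 (hA x)
  have e2 := abs_le.1 (hA (x + z))
  have e3 := abs_le.1 (hA (x - z))
  have e4 := abs_le.1 (hT x z)
  have e5 := abs_le.1 (hT x (-z))
  rw [norm_neg, map_neg, ← sub_eq_add_neg] at e5
  have m2 : 2 * (L : ℝ) * ‖z‖ ^ 2 ≤ max (4 * A) (2 * L) * ‖z‖ ^ 2 := by
    gcongr; exact le_max_right _ _
  refine le_min ((?_ : _ ≤ 4 * A).trans (le_max_left _ _)) (?_ : _ ≤ _)
  · rw [abs_le]; constructor <;> linarith
  · rw [abs_le]; constructor <;> linarith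

/-- In polar coordinates the integrand is `r^{n+1-p}` near zero and `r^{n-1-p}` at infinity, whence
the two conditions on `p`. -/
theorem integrable_min_one_sq_mul_norm_rpow {n : ℕ} (hn : 1 ≤ n) {p : ℝ} (hp : (n : ℝ) < p)
    (hp2 : p < n + 2) :
    Integrable fun z : EuclideanSpace ℝ (Fin n) => min 1 (‖z‖ ^ 2) * ‖z‖ ^ (-p) := by
  have : Nonempty (Fin n) := ⟨⟨0, hn⟩⟩
  rw [integrable_fun_norm_addHaar volume (f := fun r => min 1 (r ^ 2) * r ^ (-p)),
    finrank_euclideanSpace_fin]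
  have hn' : ((n - 1 : ℕ) : ℝ) = n - 1 := by push_cast [hn]; ring
  have e1 : ∀ r : ℝ, 0 < r → r ≤ 1 →
      r ^ (n - 1) • (min 1 (r ^ 2) * r ^ (-p)) = r ^ ((n : ℝ) + 1 - p) := by
    intro r hr hr1
    rw [min_eq_right (by nlinarith), smul_eq_mul, ← Real.rpow_natCast, hn',
      ← Real.rpow_natCast, ← Real.rpow_add hr, ← Real.rpow_add hr]
    congr 1; push_cast; ring
  have e2 : ∀ r : ℝ, 1 ≤ r →
      r ^ (n - 1) • (min 1 (r ^ 2) * r ^ (-p)) = r ^ ((n : ℝ) - 1 - p) := by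
    intro r hr1
    have hr : 0 < r := by linarith
    rw [min_eq_left (by nlinarith), smul_eq_mul, one_mul, ← Real.rpow_natCast, hn',
      ← Real.rpow_add hr]
    congr 1
  rw [← Ioc_union_Ioi_eq_Ioi zero_le_one]
  refine IntegrableOn.union ?_ ?_
  · rw [integrableOn_Ioc_iff_integrableOn_Ioo, integrableOn_congr_fun (fun r hr =>
      e1 r hr.1 hr.2.le) measurableSet_Ioo, intervalIntegral.integrableOn_Ioo_rpow_iff one_pos]
    linarith
  · rw [integrableOn_congr_fun (fun r hr => e2 r (mem_Ioi.1 hr).le) measurableSet_Ioi]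
    exact integrableOn_Ioi_rpow_of_lt (by linarith) one_pos

/-- The principal value integral written with symmetric second differences:
`½ ∫ (2 h(x) - h(x + z) - h(x - z)) |z|^{-p} dz`. -/
noncomputable def symmSingularIntegral {n : ℕ} (p : ℝ) (h : EuclideanSpace ℝ (Fin n) → ℝ)
    (x : EuclideanSpace ℝ (Fin n)) : ℝ :=
  ∫ z, (2 * h x - h (x + z) - h (x - z)) * ‖z‖ ^ (-p) / 2

theorem integrable_second_difference_mul_norm_rpow {n : ℕ} (hn : 1 ≤ n) {p : ℝ}
    (hp : (n : ℝ) < p) (hp2 : p < n + 2)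
    {h : EuclideanSpace ℝ (Fin n) → ℝ} (hh : ContDiff ℝ ∞ h) (hsupp : HasCompactSupport h)
    (x : EuclideanSpace ℝ (Fin n)) :
    Integrable fun z => (2 * h x - h (x + z) - h (x - z)) * ‖z‖ ^ (-p) / 2 := by
  obtain ⟨M, hM, hMh⟩ := exists_abs_second_difference_le hh hsupp
  have hm := hh.continuous.measurable
  refine ((integrable_min_one_sq_mul_norm_rpow hn hp hp2).const_mul M).mono'
    (by fun_prop) (.of_forall fun z => ?_)
  rw [norm_div, norm_mul, Real.norm_of_nonneg (by positivity : 0 ≤ ‖z‖ ^ (-p)), Real.norm_eq_abs,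
    Real.norm_of_nonneg zero_le_two, ← mul_assoc]
  have h1 : |2 * h x - h (x + z) - h (x - z)| * ‖z‖ ^ (-p) ≤ M * min 1 (‖z‖ ^ 2) * ‖z‖ ^ (-p) := by
    gcongr; exact hMh x z
  have h2 : 0 ≤ |2 * h x - h (x + z) - h (x - z)| * ‖z‖ ^ (-p) := by positivity
  linarith

theorem integrableOn_norm_rpow_neg {n : ℕ} {p r : ℝ} (hp : (n : ℝ) < p) (hr : 0 < r) :
    IntegrableOn (fun z : EuclideanSpace ℝ (Fin n) => ‖z‖ ^ (-p)) {z | r < ‖z‖} := by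
  have hp0 : 0 ≤ p := (Nat.cast_nonneg n).trans hp.le
  refine Integrable.mono' (g := fun z => (min 1 r / 2) ^ (-p) * (1 + ‖z‖) ^ (-p)) ?_
    (measurable_norm.pow_const _).aestronglyMeasurable ?_
  · exact ((integrable_one_add_norm (by rwa [finrank_euclideanSpace_fin])).const_mul _).integrableOn
  · filter_upwards [ae_restrict_mem (measurableSet_lt measurable_const measurable_norm)] with z hz
    have hz : r < ‖z‖ := hz
    have hz0 : 0 < ‖z‖ := hr.trans hz
    rw [Real.norm_of_nonneg (by positivity), ← Real.mul_rpow (by positivity) (by positivity)]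
    refine Real.rpow_le_rpow_of_nonpos (by positivity) ?_ (by linarith)
    have h1 : min 1 r ≤ r := min_le_right _ _
    have h2 : min 1 r * ‖z‖ ≤ 1 * ‖z‖ := by gcongr; exact min_le_left _ _
    linarith

/-- The ball-truncated singular integral in terms of symmetric second differences. -/
theorem fracLaplacianTrunc_eq_setIntegral {n : ℕ} {s r : ℝ} (hs : 0 < s) (hr : 0 < r)
    {h : EuclideanSpace ℝ (Fin n) → ℝ} (hc : Continuous h) (hsupp : HasCompactSupport h)
    (x : EuclideanSpace ℝ (Fin n)) :
    fracLaplacianTrunc s h x r = ∫ z in {z | r < ‖z‖},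
      (2 * h x - h (x + z) - h (x - z)) * ‖z‖ ^ (-((n : ℝ) + 2 * s)) / 2 := by
  set p : ℝ := (n : ℝ) + 2 * s
  have hS : MeasurableSet {z : EuclideanSpace ℝ (Fin n) | r < ‖z‖} :=
    measurableSet_lt measurable_const measurable_norm
  have hS' : MeasurableSet {y : EuclideanSpace ℝ (Fin n) | r < ‖x - y‖} :=
    measurableSet_lt measurable_const (by fun_prop)
  obtain ⟨A, hA⟩ := hc.bounded_above_of_compact_support hsupp
  have hm := hc.measurable
  -- The substitutions `y = x - z` and `y = x + z` give two expressions, which are then averaged.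
  have e1 : fracLaplacianTrunc s h x r =
      ∫ z in {z | r < ‖z‖}, (h x - h (x - z)) * ‖z‖ ^ (-p) := by
    rw [fracLaplacianTrunc, ← integral_indicator hS', ← integral_indicator hS,
      ← integral_sub_left_eq_self _ _ x]
    refine integral_congr_ae (.of_forall fun z => ?_)
    simp only [indicator, mem_ofPred_eq, sub_sub_cancel, Real.rpow_neg (norm_nonneg z), p,
      div_eq_mul_inv]
  have e2 : fracLaplacianTrunc s h x r =
      ∫ z in {z | r < ‖z‖}, (h x - h (x + z)) * ‖z‖ ^ (-p) := by
    rw [fracLaplacianTrunc, ← integral_indicator hS', ← integral_indicator hS,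
      ← integral_add_left_eq_self _ x]
    refine integral_congr_ae (.of_forall fun z => ?_)
    simp only [indicator, mem_ofPred_eq, sub_add_cancel_left, norm_neg,
      Real.rpow_neg (norm_nonneg z), p, div_eq_mul_inv]
  have hi : ∀ g : EuclideanSpace ℝ (Fin n) → EuclideanSpace ℝ (Fin n), Measurable g →
      IntegrableOn (fun z => (h x - h (g z)) * ‖z‖ ^ (-p)) {z | r < ‖z‖} := by
    intro g hg
    refine (integrableOn_norm_rpow_neg (by simp only [p]; linarith) hr).bdd_mul
      (c := A + A) (by fun_prop) (.of_forall fun z => ?_)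
    exact (norm_sub_le _ _).trans (add_le_add (hA _) (hA _))
  have : fracLaplacianTrunc s h x r = (fracLaplacianTrunc s h x r + fracLaplacianTrunc s h x r) / 2 :=
    by ring
  rw [this]
  nth_rewrite 1 [e1]
  rw [e2, ← integral_add (hi _ (by fun_prop)) (hi _ (by fun_prop)), ← integral_div]
  exact integral_congr_ae (.of_forall fun z => by simp only; ring)

/-- Second differences make the limiting integral absolutely convergent, so removing the ball is
dominated convergence. -/
theorem tendsto_fracLaplacianTrunc {n : ℕ} (hn : 1 ≤ n) {s : ℝ} (hs : 0 < s) (hs1 : s < 1)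
    {h : EuclideanSpace ℝ (Fin n) → ℝ} (hh : ContDiff ℝ ∞ h) (hsupp : HasCompactSupport h)
    (x : EuclideanSpace ℝ (Fin n)) :
    Tendsto (fracLaplacianTrunc s h x) (𝓝[>] 0)
      (𝓝 (symmSingularIntegral ((n : ℝ) + 2 * s) h x)) := by
  have : Nonempty (Fin n) := ⟨⟨0, hn⟩⟩
  set p : ℝ := (n : ℝ) + 2 * s with hp
  have hi := integrable_second_difference_mul_norm_rpow hn (p := p) (by linarith) (by linarith)
    hh hsupp x
  have hS : ∀ r : ℝ, MeasurableSet {z : EuclideanSpace ℝ (Fin n) | r < ‖z‖} := fun r =>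
    measurableSet_lt measurable_const measurable_norm
  refine Tendsto.congr' (f₁ := fun r => ∫ z, {z | r < ‖z‖}.indicator
    (fun z => (2 * h x - h (x + z) - h (x - z)) * ‖z‖ ^ (-p) / 2) z) ?_ ?_
  · filter_upwards [self_mem_nhdsWithin] with r hr
    rw [fracLaplacianTrunc_eq_setIntegral hs hr hh.continuous hsupp, integral_indicator (hS r)]
  · refine tendsto_integral_filter_of_dominated_convergence _
      (.of_forall fun r => hi.aestronglyMeasurable.indicator (hS r))
      (.of_forall fun r => .of_forall fun z => norm_indicator_le_norm_self _ _) hi.norm ?_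
    filter_upwards [compl_mem_ae_iff.2 (measure_singleton (0 : EuclideanSpace ℝ (Fin n)))] with z hz
    refine tendsto_nhds_of_eventually_eq ?_
    filter_upwards [mem_nhdsWithin_of_mem_nhds (Iio_mem_nhds (norm_pos_iff.2 hz))] with r hr
    exact indicator_of_mem (show z ∈ {z | r < ‖z‖} from hr) _

theorem fracLaplacian_eq_symmSingularIntegral {n : ℕ} (hn : 1 ≤ n) {s : ℝ} (hs : 0 < s)
    (hs1 : s < 1) {h : EuclideanSpace ℝ (Fin n) → ℝ} (hh : ContDiff ℝ ∞ h)
    (hsupp : HasCompactSupport h) (x : EuclideanSpace ℝ (Fin n)) :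
    fracLaplacian s h x =
      fracLaplacianConst n s * symmSingularIntegral ((n : ℝ) + 2 * s) h x := by
  rw [fracLaplacian, if_neg hs1.ne, (tendsto_fracLaplacianTrunc hn hs hs1 hh hsupp x).limUnder_eq]

theorem fracLaplacianConst_nonneg (n : ℕ) {s : ℝ} (hs : 0 < s) (hs1 : s < 1) :
    0 ≤ fracLaplacianConst n s := by
  have h1 : 0 < Real.Gamma ((n : ℝ) / 2 + s) := Real.Gamma_pos_of_pos (by positivity)
  have h2 : 0 < Real.Gamma (1 - s) := Real.Gamma_pos_of_pos (by linarith)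
  have := Real.pi_pos
  rw [fracLaplacianConst]
  positivity

/-- The truncated singular integrals decay like `(1 + |x|)^{-n-2s}`, uniformly in the
truncation. -/
theorem exists_abs_fracLaplacianTrunc_le {n : ℕ} (hn : 1 ≤ n) {s : ℝ} (hs : 0 < s) (hs1 : s < 1)
    {h : EuclideanSpace ℝ (Fin n) → ℝ} (hh : ContDiff ℝ ∞ h) (hsupp : HasCompactSupport h) :
    ∃ C, 0 ≤ C ∧ ∀ r, 0 < r → ∀ x,
      |fracLaplacianTrunc s h x r| ≤ C * (1 + ‖x‖) ^ (-((n : ℝ) + 2 * s)) := by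
  have : Nonempty (Fin n) := ⟨⟨0, hn⟩⟩
  set p : ℝ := (n : ℝ) + 2 * s with hp
  have hp0 : 0 < p := by positivity
  obtain ⟨M, hM, hMh⟩ := exists_abs_second_difference_le hh hsupp
  obtain ⟨R, hR1, hR⟩ : ∃ R : ℝ, 1 ≤ R ∧ ∀ x, h x ≠ 0 → ‖x‖ ≤ R := by
    obtain ⟨R, hR⟩ := hsupp.isCompact.isBounded.exists_norm_le
    exact ⟨max 1 R, le_max_left _ _, fun x hx =>
      (hR x (subset_tsupport _ hx)).trans (le_max_right _ _)⟩
  have henv := integrable_min_one_sq_mul_norm_rpow hn (p := p) (by linarith) (by linarith)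
  have hih : Integrable h := hh.continuous.integrable_of_hasCompactSupport hsupp
  obtain ⟨I, hI⟩ : ∃ I : ℝ,
      I = ∫ z : EuclideanSpace ℝ (Fin n), M * (min 1 (‖z‖ ^ 2) * ‖z‖ ^ (-p)) := ⟨_, rfl⟩
  have hI0 : 0 ≤ I := hI ▸ integral_nonneg fun z => by positivity
  obtain ⟨J, hJ⟩ : ∃ J : ℝ, J = ∫ y, ‖h y‖ := ⟨_, rfl⟩
  have hJ0 : 0 ≤ J := hJ ▸ integral_nonneg fun z => by positivity
  -- `I` bounds the integral by second differences for `|x| ≤ 2R`. For `|x| ≥ 2R` one has `h x = 0`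
  -- and `|x - y| ≥ (1 + |x|)/4` on the support of `h`, which gives `J * 4 ^ p`.
  refine ⟨I * (1 + 2 * R) ^ p + J * 4 ^ p, by positivity, fun r hr x => ?_⟩
  rcases le_total ‖x‖ (2 * R) with hx | hx
  · have h1 : |fracLaplacianTrunc s h x r| ≤ I := by
      rw [fracLaplacianTrunc_eq_setIntegral hs hr hh.continuous hsupp, ← Real.norm_eq_abs, hI]
      refine (norm_integral_le_of_norm_le (henv.const_mul M).integrableOn
        (.of_forall fun z => ?_)).trans
        (setIntegral_le_integral (henv.const_mul M) (.of_forall fun z => by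
          simp only [Pi.zero_apply]; positivity))
      rw [norm_div, norm_mul, Real.norm_of_nonneg (by positivity : 0 ≤ ‖z‖ ^ (-p)),
        Real.norm_eq_abs, Real.norm_of_nonneg zero_le_two, ← mul_assoc]
      have h1 : |2 * h x - h (x + z) - h (x - z)| * ‖z‖ ^ (-p) ≤
          M * min 1 (‖z‖ ^ 2) * ‖z‖ ^ (-p) := by
        gcongr; exact hMh x z
      have h2 : 0 ≤ |2 * h x - h (x + z) - h (x - z)| * ‖z‖ ^ (-p) := by positivity
      linarith
    have h2 : 1 ≤ (1 + 2 * R) ^ p * (1 + ‖x‖) ^ (-p) := by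
      rw [Real.rpow_neg (by positivity), ← div_eq_mul_inv, one_le_div (by positivity)]
      gcongr
    calc _ ≤ I * 1 := by rwa [mul_one]
      _ ≤ I * ((1 + 2 * R) ^ p * (1 + ‖x‖) ^ (-p)) := by gcongr
      _ ≤ _ := by
        have : 0 ≤ J * 4 ^ p * (1 + ‖x‖) ^ (-p) := by positivity
        linarith
  · have hhx : h x = 0 := by
      by_contra hne
      linarith [hR x hne]
    have h1 : |fracLaplacianTrunc s h x r| ≤ ∫ y, ‖h y‖ * (4 ^ p * (1 + ‖x‖) ^ (-p)) := by
      rw [fracLaplacianTrunc, ← Real.norm_eq_abs]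
      refine (norm_integral_le_of_norm_le (hih.norm.mul_const _).integrableOn
        (.of_forall fun y => ?_)).trans
        (setIntegral_le_integral (hih.norm.mul_const _) (.of_forall fun z => by
          simp only [Pi.zero_apply]; positivity))
      by_cases hy : h y = 0
      · simp [hhx, hy]
      · have h3 := hR y hy
        have h4 : (1 + ‖x‖) / 4 ≤ ‖x - y‖ := by
          have := norm_sub_norm_le x y
          linarith
        rw [hhx, zero_sub, norm_div, norm_neg, div_eq_mul_inv,
          Real.norm_of_nonneg (by positivity : 0 ≤ ‖x - y‖ ^ ((n : ℝ) + 2 * s)), ← hp,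
          ← Real.rpow_neg (norm_nonneg _)]
        gcongr ?_ * ?_
        refine (Real.rpow_le_rpow_of_nonpos (by positivity) h4 (by linarith)).trans_eq ?_
        rw [div_eq_inv_mul, Real.mul_rpow (by positivity) (by positivity),
          Real.inv_rpow (by positivity), Real.rpow_neg (by positivity) p, inv_inv]
    rw [integral_mul_const, ← hJ] at h1
    have : 0 ≤ I * (1 + 2 * R) ^ p * (1 + ‖x‖) ^ (-p) := by positivity
    linarith

/-! ### Comparison of the symmetric truncation with ball truncations. -/

namespace truncKernel

variable {n : ℕ} {p ε : ℝ}

/-- With `d = |x - y|` and `|y| ≤ |x| + d`, it is enough that `d(d - ε²|x|) > ε²|x|²`; for `d > ε(1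
+ ε)|x|` the left side exceeds `ε²(1 + ε)|x|²`. -/
theorem eq_of_lt_norm_sub (hε : 0 < ε) {x y : EuclideanSpace ℝ (Fin n)}
    (h : ε * (1 + ε) * ‖x‖ < ‖x - y‖) : truncKernel p ε x y = ‖x - y‖ ^ (-p) := by
  rw [truncKernel, if_pos]
  have hx := norm_nonneg x
  have h1 : ‖y‖ ≤ ‖x‖ + ‖x - y‖ := by
    have := norm_sub_norm_le y x
    rw [norm_sub_rev] at this
    linarith
  have h2 : ε ^ 2 * (‖x‖ * ‖y‖) ≤ ε ^ 2 * (‖x‖ * (‖x‖ + ‖x - y‖)) := by gcongr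
  have h3 : 0 ≤ ε * (1 + ε) * ‖x‖ := by positivity
  have h4 : 0 ≤ ε * ‖x‖ := by positivity
  have h5 : (ε * (1 + ε) * ‖x‖) * (ε * ‖x‖) < ‖x - y‖ * (‖x - y‖ - ε ^ 2 * ‖x‖) :=
    mul_lt_mul'' h (by linarith) h3 h4
  have h6 : 0 ≤ ε ^ 3 * ‖x‖ ^ 2 := by positivity
  linarith

/-- Mirror image of the outer radius, from `|y| ≥ |x| - |x - y|`. The truncation boundary thus lies
in a shell of thickness `2ε²|x|`. -/
theorem eq_zero_of_norm_sub_le (hε : 0 < ε) {x y : EuclideanSpace ℝ (Fin n)}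
    (h : ‖x - y‖ ≤ ε * (1 - ε) * ‖x‖) : truncKernel p ε x y = 0 := by
  rw [truncKernel, if_neg]
  rw [not_lt]
  have hx := norm_nonneg x
  have h1 : ‖x‖ - ‖x - y‖ ≤ ‖y‖ := by
    have := norm_sub_norm_le x y
    linarith
  have h2 : ε ^ 2 * (‖x‖ * (‖x‖ - ‖x - y‖)) ≤ ε ^ 2 * (‖x‖ * ‖y‖) := by gcongr
  have h4 : 0 ≤ ε * ‖x‖ := by positivity
  have h3 : 0 ≤ ε * (1 - ε) * ‖x‖ := (norm_nonneg _).trans h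
  have h5 : ‖x - y‖ * (‖x - y‖ + ε ^ 2 * ‖x‖) ≤ (ε * (1 - ε) * ‖x‖) * (ε * ‖x‖) :=
    mul_le_mul h (by linarith) (by positivity) h3
  have h6 : 0 ≤ ε ^ 3 * ‖x‖ ^ 2 := by positivity
  linarith

theorem integrable_sub_mul (hp : (n : ℝ) < p) (hε : 0 < ε) {h : EuclideanSpace ℝ (Fin n) → ℝ}
    (hc : Continuous h) (hsupp : HasCompactSupport h)
    {x : EuclideanSpace ℝ (Fin n)} (hx : x ≠ 0) :
    Integrable fun y => (h x - h y) * truncKernel p ε x y := by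
  obtain ⟨A, hA⟩ := hc.bounded_above_of_compact_support hsupp
  obtain ⟨C, hC, hCK⟩ := truncKernel.le_one_add_norm_rpow (n := n) hε
    ((Nat.cast_nonneg n).trans_lt hp) (norm_pos_iff.2 hx)
  have h1 : Integrable fun y => truncKernel p ε x y := by
    refine ((integrable_one_add_norm (μ := volume) (E := EuclideanSpace ℝ (Fin n))
      (r := p) (by rwa [finrank_euclideanSpace_fin])).const_mul C).mono'
        (truncKernel.measurable_right x).aestronglyMeasurable (.of_forall fun y => ?_)
    rw [Real.norm_of_nonneg (truncKernel.nonneg _ _), truncKernel.symm]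
    exact hCK y x le_rfl
  exact h1.bdd_mul (c := A + A) (by fun_prop)
    (.of_forall fun y => (norm_sub_le _ _).trans (add_le_add (hA _) (hA _)))

end truncKernel

/-- The shell is thinner than its radius by a factor of order `ε`. This extra power matters: with a
Lipschitz bound on `h`, the volume `ε^n` of a full ball would only give `ε^{1-2s}`, which need not
tend to zero. -/
theorem measureReal_annulus_le {n : ℕ} {X ε : ℝ} (hX : 0 ≤ X) (hε : 0 < ε)
    (hε1 : ε ≤ 1) (x : EuclideanSpace ℝ (Fin n)) :
    (volume : Measure (EuclideanSpace ℝ (Fin n))).real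
      (Metric.closedBall x (ε * (1 + ε) * X) \ Metric.closedBall x (ε * (1 - ε) * X)) ≤
      ε ^ (n + 1) * (2 * n * 2 ^ (n - 1) * X ^ n * volume.real
        (Metric.ball (0 : EuclideanSpace ℝ (Fin n)) 1)) := by
  have h0 : 0 ≤ 1 - ε := by linarith
  have h1 : ε * (1 - ε) * X ≤ ε * (1 + ε) * X := by gcongr; linarith
  rw [measureReal_sdiff (Metric.closedBall_subset_closedBall h1)
    Metric.isClosed_closedBall.measurableSet measure_closedBall_lt_top.ne,
    Measure.addHaar_real_closedBall _ _ (by positivity),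
    Measure.addHaar_real_closedBall _ _ (by positivity), finrank_euclideanSpace_fin, ← sub_mul]
  have h2 := (le_abs_self _).trans (abs_pow_sub_pow_le (1 + ε) (1 - ε) n)
  rw [abs_of_nonneg h0, abs_of_nonneg (by linarith : 0 ≤ 1 + ε), max_eq_left (by linarith),
    show 1 + ε - (1 - ε) = 2 * ε by ring, abs_of_pos (by linarith)] at h2
  have h3 : (1 + ε) ^ (n - 1) ≤ 2 ^ (n - 1) := by gcongr; linarith
  have h4 : (1 + ε) ^ n - (1 - ε) ^ n ≤ 2 * ε * n * 2 ^ (n - 1) := h2.trans (by gcongr)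
  have hV : 0 ≤ volume.real (Metric.ball (0 : EuclideanSpace ℝ (Fin n)) 1) := measureReal_nonneg
  calc ((ε * (1 + ε) * X) ^ n - (ε * (1 - ε) * X) ^ n) *
        volume.real (Metric.ball (0 : EuclideanSpace ℝ (Fin n)) 1)
      = ε ^ n * X ^ n * ((1 + ε) ^ n - (1 - ε) ^ n) *
        volume.real (Metric.ball (0 : EuclideanSpace ℝ (Fin n)) 1) := by
          simp only [mul_pow]; ring
    _ ≤ ε ^ n * X ^ n * (2 * ε * n * 2 ^ (n - 1)) *
        volume.real (Metric.ball (0 : EuclideanSpace ℝ (Fin n)) 1) := by gcongr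
    _ = _ := by ring

/-- The two truncations of the singular integral differ by `O(ε^{n+2-p})`. -/
theorem exists_abs_integral_truncKernel_sub_le {n : ℕ} (hn : 1 ≤ n) {s : ℝ} (hs : 0 < s)
    {h : EuclideanSpace ℝ (Fin n) → ℝ} (hh : ContDiff ℝ ∞ h)
    (hsupp : HasCompactSupport h) {ρ : ℝ} (hρ : 0 < ρ) (hρh : ∀ x, h x ≠ 0 → ρ ≤ ‖x‖) :
    ∃ C, 0 ≤ C ∧ ∀ ε, 0 < ε → ε ≤ 1 / 2 → ∀ x, x ≠ 0 →
      |(∫ y, (h x - h y) * truncKernel ((n : ℝ) + 2 * s) ε x y) -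
        fracLaplacianTrunc s h x (ε * (1 + ε) * ‖x‖)| ≤
        C * ε ^ (2 - 2 * s) * (1 + ‖x‖) ^ (-((n : ℝ) + 2 * s)) := by
  set p : ℝ := (n : ℝ) + 2 * s with hp
  have hnp : (n : ℝ) < p := by linarith
  have hn1 : (1 : ℝ) ≤ n := by exact_mod_cast hn
  have hp0 : 0 < p := by linarith
  obtain ⟨L, hL⟩ := ContDiff.lipschitzWith_of_hasCompactSupport hsupp hh (by simp)
  obtain ⟨R, hR1, hR⟩ : ∃ R : ℝ, 0 ≤ R ∧ ∀ x, h x ≠ 0 → ‖x‖ ≤ R := by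
    obtain ⟨R, hR⟩ := hsupp.isCompact.isBounded.exists_norm_le
    exact ⟨max 0 R, le_max_left _ _, fun x hx =>
      (hR x (subset_tsupport _ hx)).trans (le_max_right _ _)⟩
  obtain ⟨V, hV⟩ : ∃ V, V = (volume : Measure (EuclideanSpace ℝ (Fin n))).real
    (Metric.ball 0 1) := ⟨_, rfl⟩
  have hV0 : 0 ≤ V := hV ▸ measureReal_nonneg
  -- A Lipschitz bound times the kernel gives `L r₁^{1-p}` on the shell. Only `ρ/2 ≤ |x| ≤ 4R`
  -- matters, where `r₁ ≥ ερ/4`; the last factor absorbs the weight `(1 + |x|)^{-p}`.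
  refine ⟨L * (ρ / 4) ^ (1 - p) * (2 * n * 2 ^ (n - 1) * (4 * R) ^ n * V) * (1 + 4 * R) ^ p,
    by positivity, fun ε hε hε2 x hx => ?_⟩
  have hx' : 0 < ‖x‖ := norm_pos_iff.2 hx
  set r₁ := ε * (1 - ε) * ‖x‖ with hr₁
  set r₂ := ε * (1 + ε) * ‖x‖ with hr₂
  have hr₁0 : 0 < r₁ := by
    have : 0 < 1 - ε := by linarith
    positivity
  set S : Set (EuclideanSpace ℝ (Fin n)) := {y | r₂ < ‖x - y‖} with hS
  have hSm : MeasurableSet S := measurableSet_lt measurable_const (by fun_prop)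
  have hKi := truncKernel.integrable_sub_mul hnp hε hh.continuous hsupp hx
  have e1 : fracLaplacianTrunc s h x r₂ =
      ∫ y, S.indicator (fun y => (h x - h y) * truncKernel p ε x y) y := by
    rw [integral_indicator hSm, fracLaplacianTrunc]
    refine setIntegral_congr_fun hSm fun y hy => ?_
    beta_reduce
    rw [truncKernel.eq_of_lt_norm_sub hε hy, Real.rpow_neg (norm_nonneg _), div_eq_mul_inv]
  rw [e1, ← integral_sub hKi (hKi.indicator hSm)]
  -- Since `ε ≤ 1/2`, points inside the outer radius satisfy `|x - y| ≤ 3|x|/4`; outside this range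
  -- of `|x|`, both `h x` and `h y` vanish there.
  by_cases hX : ρ / 2 ≤ ‖x‖ ∧ ‖x‖ ≤ 4 * R
  · set T := Metric.closedBall x r₂ \ Metric.closedBall x r₁ with hT
    have hTm : MeasurableSet T :=
      Metric.isClosed_closedBall.measurableSet.diff Metric.isClosed_closedBall.measurableSet
    have hTi : Integrable (T.indicator fun _ => (L : ℝ) * r₁ ^ (1 - p)) := by
      rw [integrable_indicator_iff hTm]
      exact integrableOn_const ((measure_mono sdiff_subset).trans_lt measure_closedBall_lt_top).ne
    have hle : |∫ y, ((h x - h y) * truncKernel p ε x y -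
        S.indicator (fun y => (h x - h y) * truncKernel p ε x y) y)| ≤
        ∫ y, T.indicator (fun _ => (L : ℝ) * r₁ ^ (1 - p)) y := by
      rw [← Real.norm_eq_abs]
      refine norm_integral_le_of_norm_le hTi (.of_forall fun y => ?_)
      have hT0 : 0 ≤ T.indicator (fun _ => (L : ℝ) * r₁ ^ (1 - p)) y :=
        indicator_nonneg (fun _ _ => by positivity) _
      by_cases hyS : y ∈ S
      · rw [indicator_of_mem hyS, sub_self, norm_zero]
        exact hT0
      · rw [indicator_of_notMem hyS, sub_zero]
        rcases le_or_gt ‖x - y‖ r₁ with hy | hy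
        · rw [truncKernel.eq_zero_of_norm_sub_le hε hy, mul_zero, norm_zero]
          exact hT0
        · have hyT : y ∈ T := by
            refine ⟨?_, ?_⟩
            · rw [Metric.mem_closedBall', dist_eq_norm]
              exact not_lt.1 hyS
            · rw [Metric.mem_closedBall', dist_eq_norm]
              exact not_le.2 hy
          have hd : 0 < ‖x - y‖ := hr₁0.trans hy
          rw [indicator_of_mem hyT, norm_mul, Real.norm_of_nonneg (truncKernel.nonneg _ _)]
          have hK : truncKernel p ε x y ≤ ‖x - y‖ ^ (-p) := by
            rw [truncKernel]
            split_ifs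
            · exact le_rfl
            · positivity
          calc ‖h x - h y‖ * truncKernel p ε x y ≤ (L * ‖x - y‖) * ‖x - y‖ ^ (-p) := by
                gcongr
                · exact truncKernel.nonneg _ _
                · exact hL.norm_sub_le x y
            _ = L * ‖x - y‖ ^ (1 - p) := by
                rw [sub_eq_add_neg 1 p, Real.rpow_add hd, Real.rpow_one, mul_assoc]
            _ ≤ L * r₁ ^ (1 - p) := by
                gcongr ?_ * ?_
                exact Real.rpow_le_rpow_of_nonpos hr₁0 hy.le (by linarith)
    refine hle.trans ?_
    rw [integral_indicator_const _ hTm, smul_eq_mul]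
    have hvol : volume.real T ≤ ε ^ (n + 1) * (2 * n * 2 ^ (n - 1) * (4 * R) ^ n * V) := by
      refine (measureReal_annulus_le hx'.le hε (by linarith) x).trans ?_
      rw [← hV]
      gcongr
      exact hX.2
    have hr : r₁ ^ (1 - p) ≤ ε ^ (1 - p) * (ρ / 4) ^ (1 - p) := by
      rw [← Real.mul_rpow hε.le (by positivity)]
      refine Real.rpow_le_rpow_of_nonpos (by positivity) ?_ (by linarith)
      rw [hr₁, mul_assoc]
      have : 1 / 2 * (ρ / 2) ≤ (1 - ε) * ‖x‖ := by
        gcongr ?_ * ?_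
        · linarith
        · linarith
        · exact hX.1
      gcongr
      linarith
    have hone : 1 ≤ (1 + 4 * R) ^ p * (1 + ‖x‖) ^ (-p) := by
      rw [Real.rpow_neg (by positivity), ← div_eq_mul_inv, one_le_div (by positivity)]
      gcongr
      exact hX.2
    have hεp : ε ^ (n + 1) * ε ^ (1 - p) = ε ^ (2 - 2 * s) := by
      rw [← Real.rpow_natCast, ← Real.rpow_add hε]
      congr 1; push_cast; rw [hp]; ring
    calc volume.real T * (L * r₁ ^ (1 - p))
        ≤ ε ^ (n + 1) * (2 * n * 2 ^ (n - 1) * (4 * R) ^ n * V) *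
          (L * (ε ^ (1 - p) * (ρ / 4) ^ (1 - p))) := by gcongr
      _ = L * (ρ / 4) ^ (1 - p) * (2 * n * 2 ^ (n - 1) * (4 * R) ^ n * V) *
          (ε ^ (n + 1) * ε ^ (1 - p)) * 1 := by ring
      _ ≤ L * (ρ / 4) ^ (1 - p) * (2 * n * 2 ^ (n - 1) * (4 * R) ^ n * V) *
          (ε ^ (n + 1) * ε ^ (1 - p)) * ((1 + 4 * R) ^ p * (1 + ‖x‖) ^ (-p)) := by gcongr
      _ = _ := by rw [hεp]; ring
  · have hz : ∀ y, (h x - h y) * truncKernel p ε x y -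
        S.indicator (fun y => (h x - h y) * truncKernel p ε x y) y = 0 := by
      intro y
      by_cases hyS : y ∈ S
      · rw [indicator_of_mem hyS, sub_self]
      · rw [indicator_of_notMem hyS, sub_zero]
        have hy : ‖x - y‖ ≤ 3 / 4 * ‖x‖ := by
          refine (not_lt.1 hyS).trans ?_
          rw [hr₂]
          gcongr
          nlinarith
        have h1 := norm_sub_norm_le x y
        have h2 := norm_sub_norm_le y x
        rw [norm_sub_rev] at h2
        have hxz : h x = 0 := by
          by_contra hne
          exact hX ⟨by linarith [hρh x hne], by linarith [hR x hne]⟩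
        have hyz : h y = 0 := by
          by_contra hne
          exact hX ⟨by linarith [hρh y hne], by linarith [hR y hne]⟩
        rw [hxz, hyz, sub_zero, zero_mul]
    simp only [hz, integral_zero, abs_zero]
    positivity

/-! ### The case `s < 1`: passage to the limit. -/

theorem IsTestFunctionOn.exists_le_norm {n : ℕ} {h : EuclideanSpace ℝ (Fin n) → ℝ}
    (hh : IsTestFunctionOn {0}ᶜ h) : ∃ ρ : ℝ, 0 < ρ ∧ ∀ x, h x ≠ 0 → ρ ≤ ‖x‖ := by
  have h1 : (tsupport h)ᶜ ∈ 𝓝 (0 : EuclideanSpace ℝ (Fin n)) :=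
    (isClosed_tsupport h).isOpen_compl.mem_nhds fun h0 => hh.tsupport_subset h0 rfl
  obtain ⟨ρ, hρ, hρh⟩ := Metric.mem_nhds_iff.1 h1
  refine ⟨ρ, hρ, fun x hx => ?_⟩
  by_contra! hlt
  exact hρh (by simpa using hlt) (subset_tsupport h hx)

theorem fracLaplacian_pairing_of_lt_one {n : ℕ} (hn : 1 ≤ n) {s : ℝ} (hs : 0 < s) (hs1 : s < 1)
    {v : ℝ → ℝ} (hv : Measurable v)
    (hint : Integrable (fun x : EuclideanSpace ℝ (Fin n) =>
      v ‖x‖ * (1 + ‖x‖) ^ (-((n : ℝ) + 2 * s))))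
    (hineq : ∀ r : ℝ, 0 < r → ∀ τ : ℝ, 1 ≤ τ →
      v r - v (r * τ) + (v r - v (r / τ)) * τ ^ (-(n : ℝ) + 2 * s) ≤ 0)
    {h : EuclideanSpace ℝ (Fin n) → ℝ} (hh : IsTestFunctionOn {0}ᶜ h) (h0 : ∀ x, 0 ≤ h x) :
    Integrable (fun x => v ‖x‖ * fracLaplacian s h x) ∧
      ∫ x, v ‖x‖ * fracLaplacian s h x ≤ 0 := by
  have : Nonempty (Fin n) := ⟨⟨0, hn⟩⟩
  set p : ℝ := (n : ℝ) + 2 * s with hp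
  obtain ⟨hd, hsupp, -⟩ := id hh
  obtain ⟨ρ, hρ, hρh⟩ := hh.exists_le_norm
  obtain ⟨C, hC, hCh⟩ := exists_abs_fracLaplacianTrunc_le hn hs hs1 hd hsupp
  obtain ⟨C', hC', hCh'⟩ := exists_abs_integral_truncKernel_sub_le hn hs hd hsupp hρ hρh
  have hm : Measurable h := hd.continuous.measurable
  have hlim := tendsto_fracLaplacianTrunc hn hs hs1 hd hsupp
  have hbound : ∀ x, |symmSingularIntegral p h x| ≤ C * (1 + ‖x‖) ^ (-p) := fun x =>
    le_of_tendsto (hlim x).abs (by filter_upwards [self_mem_nhdsWithin] with r hr using hCh r hr x)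
  have hmeas : AEStronglyMeasurable (symmSingularIntegral p h) volume := by
    refine (StronglyMeasurable.integral_prod_right (f := fun x z =>
      (2 * h x - h (x + z) - h (x - z)) * ‖z‖ ^ (-p) / 2) ?_).aestronglyMeasurable
    exact Measurable.stronglyMeasurable (by unfold Function.uncurry; fun_prop)
  have hi : Integrable (fun x => v ‖x‖ * symmSingularIntegral p h x) :=
    integrable_radial_mul_of_le hv hint hmeas (.of_forall hbound)
  have hle : ∫ x, v ‖x‖ * symmSingularIntegral p h x ≤ 0 := by
    have hT : ∀ ε : ℝ, AEStronglyMeasurable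
        (fun x => ∫ y, (h x - h y) * truncKernel p ε x y) volume := fun ε => by
      refine (StronglyMeasurable.integral_prod_right (f := fun x y =>
        (h x - h y) * truncKernel p ε x y) ?_).aestronglyMeasurable
      exact Measurable.stronglyMeasurable (Measurable.mul
        (by fun_prop : Measurable fun z : EuclideanSpace ℝ (Fin n) × EuclideanSpace ℝ (Fin n) =>
          h z.1 - h z.2) truncKernel.measurable_uncurry)
    have hsmall : ∀ᶠ ε : ℝ in 𝓝[>] 0, 0 < ε ∧ ε ≤ 1 / 2 := by
      filter_upwards [self_mem_nhdsWithin, mem_nhdsWithin_of_mem_nhds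
        (Iic_mem_nhds (by norm_num : (0 : ℝ) < 1 / 2))] with ε h1 h2 using ⟨h1, h2⟩
    have hne : ∀ᵐ x : EuclideanSpace ℝ (Fin n), x ≠ 0 :=
      compl_mem_ae_iff.2 (measure_singleton 0)
    refine le_of_tendsto (f := fun ε => ∫ x, v ‖x‖ * ∫ y, (h x - h y) * truncKernel p ε x y)
      (x := 𝓝[>] 0) ?_ ?_
    · refine tendsto_integral_filter_of_dominated_convergence
        (fun x => (C + C') * ‖v ‖x‖ * (1 + ‖x‖) ^ (-p)‖) (.of_forall fun ε =>
          (by fun_prop : Measurable fun x : EuclideanSpace ℝ (Fin n) =>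
            v ‖x‖).aestronglyMeasurable.mul (hT ε)) ?_ (hint.norm.const_mul _) ?_
      -- The ball truncation is bounded uniformly in its radius by `C`, and the discrepancy by `C'`,
      -- because `ε^{2-2s} ≤ 1`.
      · filter_upwards [hsmall] with ε hε
        filter_upwards [hne] with x hx
        have hx' : 0 < ‖x‖ := norm_pos_iff.2 hx
        have hε1 : ε ^ (2 - 2 * s) ≤ 1 :=
          Real.rpow_le_one hε.1.le (by linarith [hε.2]) (by linarith)
        have h1 := hCh' ε hε.1 hε.2 x hx
        have h2 := hCh (ε * (1 + ε) * ‖x‖) (by have := hε.1; positivity) x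
        have h3 : C' * ε ^ (2 - 2 * s) * (1 + ‖x‖) ^ (-p) ≤ C' * 1 * (1 + ‖x‖) ^ (-p) := by
          gcongr
        have h4 := (abs_sub_abs_le_abs_sub _ _).trans h1
        rw [norm_mul, norm_mul, Real.norm_of_nonneg (by positivity : 0 ≤ (1 + ‖x‖) ^ (-p)),
          mul_left_comm]
        gcongr
        rw [Real.norm_eq_abs]
        linarith
      · filter_upwards [hne] with x hx
        have hx' : 0 < ‖x‖ := norm_pos_iff.2 hx
        refine Tendsto.const_mul _ ?_
        -- The comparison radius depends on `x`, which is harmless as only the limit at fixed `x` is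
        -- needed.
        have hr : Tendsto (fun ε : ℝ => ε * (1 + ε) * ‖x‖) (𝓝[>] 0) (𝓝[>] 0) := by
          refine tendsto_nhdsWithin_iff.2 ⟨?_, ?_⟩
          · have : Continuous fun ε : ℝ => ε * (1 + ε) * ‖x‖ := by fun_prop
            simpa using (this.tendsto 0).mono_left nhdsWithin_le_nhds
          · filter_upwards [self_mem_nhdsWithin] with ε hε
            have hε : 0 < ε := hε
            exact mem_Ioi.2 (by positivity)
        have hd0 : Tendsto (fun ε : ℝ => (∫ y, (h x - h y) * truncKernel p ε x y) -
            fracLaplacianTrunc s h x (ε * (1 + ε) * ‖x‖)) (𝓝[>] 0) (𝓝 0) := by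
          refine squeeze_zero_norm' (a := fun ε : ℝ =>
            C' * ε ^ (2 - 2 * s) * (1 + ‖x‖) ^ (-p)) ?_ ?_
          · filter_upwards [hsmall] with ε hε using hCh' ε hε.1 hε.2 x hx
          · have : Tendsto (fun ε : ℝ => ε ^ (2 - 2 * s)) (𝓝[>] 0) (𝓝 0) := by
              have := (Real.continuous_rpow_const (q := 2 - 2 * s) (by linarith)).tendsto 0
              rw [Real.zero_rpow (by linarith)] at this
              exact this.mono_left nhdsWithin_le_nhds
            simpa using (this.const_mul C').mul_const ((1 + ‖x‖) ^ (-p))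
        simpa using hd0.add ((hlim x).comp hr)
    · filter_upwards [hsmall] with ε hε
      exact integral_radial_mul_truncKernel_nonpos hn hs hε.1 hv hint hineq hd.continuous hsupp
        hρ hρh h0
  have heq : (fun x => v ‖x‖ * fracLaplacian s h x) =
      fun x => fracLaplacianConst n s * (v ‖x‖ * symmSingularIntegral p h x) := by
    ext x
    rw [fracLaplacian_eq_symmSingularIntegral hn hs hs1 hd hsupp]
    ring
  rw [heq, integral_const_mul]
  exact ⟨hi.const_mul _, mul_nonpos_of_nonneg_of_nonpos (fracLaplacianConst_nonneg n hs hs1) hle⟩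

/-! ### The case `s = 1`: second difference quotients. -/

/-- Cauchy's mean value theorem compares `φ(t) + φ(-t)` with `t²`, and the ordinary one handles `φ'`
on `[-ξ, ξ]`. An exact value of `φ''` gives both the limit and the domination. -/
theorem exists_symmetric_second_difference_eq {φ φ' φ'' : ℝ → ℝ}
    (h1 : ∀ t, HasDerivAt φ (φ' t) t) (h2 : ∀ t, HasDerivAt φ' (φ'' t) t) {a : ℝ} (ha : 0 < a) :
    ∃ η ∈ Ioo (-a) a, φ a + φ (-a) - 2 * φ 0 = a ^ 2 * φ'' η := by
  have hψ : ∀ t, HasDerivAt (fun t => φ t + φ (-t)) (φ' t - φ' (-t)) t := fun t => by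
    exact ((h1 t).add ((h1 (-t)).comp t (hasDerivAt_neg t))).congr_deriv (by ring)
  obtain ⟨ξ, hξ, e1⟩ := exists_ratio_hasDerivAt_eq_ratio_slope (fun t => φ t + φ (-t))
    (fun t => φ' t - φ' (-t)) ha (fun t _ => (hψ t).continuousAt.continuousWithinAt)
    (fun t _ => hψ t) (fun t => t ^ 2) (fun t => 2 * t) (by fun_prop)
    (fun t _ => by simpa using hasDerivAt_pow 2 t)
  obtain ⟨η, hη, e2⟩ := exists_hasDerivAt_eq_slope φ' φ'' (show -ξ < ξ by linarith [hξ.1])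
    (fun t _ => (h2 t).continuousAt.continuousWithinAt) (fun t _ => h2 t)
  refine ⟨η, ⟨by linarith [hη.1, hξ.2], by linarith [hη.2, hξ.2]⟩, ?_⟩
  have hξ0 := hξ.1
  rw [eq_div_iff (by linarith)] at e2
  rw [← e2] at e1
  simp only [neg_zero] at e1
  have : (2 * ξ) * (φ a + φ (-a) - 2 * φ 0) = (2 * ξ) * (a ^ 2 * φ'' η) := by linarith
  exact mul_left_cancel₀ (by positivity) this

/-- Symmetric second difference quotients of a family of functions converge, tested against a
weight. -/
theorem tendsto_integral_mul_second_difference {E : Type*} [TopologicalSpace E]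
    [MeasurableSpace E] [T2Space E] [OpensMeasurableSpace E] {μ : Measure E}
    {G G' G'' : ℝ → E → ℝ}
    (h1 : ∀ t x, HasDerivAt (G · x) (G' t x) t) (h2 : ∀ t x, HasDerivAt (G' · x) (G'' t x) t)
    (hG : ∀ t, Measurable (G t)) (hc : Continuous (Function.uncurry G'')) {K : Set E}
    (hK : IsCompact K) (hsupp : ∀ t ∈ Icc (-1 : ℝ) 1, ∀ x ∉ K, G'' t x = 0) {w : E → ℝ}
    (hwm : AEStronglyMeasurable w μ) (hw : IntegrableOn w K μ) :
    Tendsto (fun a => ∫ x, w x * ((G a x + G (-a) x - 2 * G 0 x) / a ^ 2) ∂μ) (𝓝[>] 0)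
      (𝓝 (∫ x, w x * G'' 0 x ∂μ)) := by
  obtain ⟨M, hM⟩ := (isCompact_Icc.prod hK).exists_bound_of_continuousOn
    (f := Function.uncurry G'') (s := Icc (-1 : ℝ) 1 ×ˢ K) hc.continuousOn
  have hlt1 : ∀ᶠ a : ℝ in 𝓝[>] 0, a < 1 := mem_nhdsWithin_of_mem_nhds (Iio_mem_nhds one_pos)
  have key : ∀ a : ℝ, 0 < a → ∀ x, ∃ η ∈ Ioo (-a) a,
      (G a x + G (-a) x - 2 * G 0 x) / a ^ 2 = G'' η x := fun a ha x => by
    obtain ⟨η, hη, e⟩ := exists_symmetric_second_difference_eq (h1 · x) (h2 · x) ha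
    exact ⟨η, hη, by rw [e]; field_simp⟩
  refine tendsto_integral_filter_of_dominated_convergence (K.indicator fun x => ‖w x‖ * M)
    (.of_forall fun a => hwm.mul (by fun_prop)) ?_
    ((integrable_indicator_iff hK.measurableSet).2 (hw.norm.mul_const M)) ?_
  · filter_upwards [self_mem_nhdsWithin, hlt1] with a ha ha1
    refine .of_forall fun x => ?_
    obtain ⟨η, hη, e⟩ := key a ha x
    have hη1 : η ∈ Icc (-1 : ℝ) 1 := ⟨by linarith [hη.1], by linarith [hη.2]⟩
    rw [e]
    by_cases hx : x ∈ K
    · rw [indicator_of_mem hx, norm_mul]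
      gcongr
      exact hM (η, x) ⟨hη1, hx⟩
    · rw [indicator_of_notMem hx, hsupp η hη1 x hx, mul_zero, norm_zero]
  · refine .of_forall fun x => Tendsto.const_mul _ ?_
    have hcx : Continuous fun t => G'' t x := hc.comp (Continuous.prodMk_left x)
    rw [Metric.tendsto_nhds]
    intro ε hε
    obtain ⟨δ, hδ, hδG⟩ := Metric.continuousAt_iff.1 (hcx.continuousAt (x := 0)) ε hε
    filter_upwards [self_mem_nhdsWithin, mem_nhdsWithin_of_mem_nhds (Iio_mem_nhds hδ)] with a ha haδ
    obtain ⟨η, hη, e⟩ := key a ha x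
    rw [e]
    refine hδG ?_
    rw [Real.dist_eq, sub_zero, abs_lt]
    have haδ : a < δ := haδ
    exact ⟨by linarith [hη.1], by linarith [hη.2]⟩

/-! ### Second derivatives along linear flows. -/

section LinearFlow

variable {E : Type*} [NormedAddCommGroup E] [NormedSpace ℝ E]

/-- The one-parameter group `t ↦ exp (t A)` of a bounded operator. -/
noncomputable def linearFlow (A : E →L[ℝ] E) (t : ℝ) : E →L[ℝ] E := NormedSpace.exp (t • A)

theorem linearFlow_zero (A : E →L[ℝ] E) (x : E) : linearFlow A 0 x = x := by
  simp [linearFlow]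

theorem linearFlow_one (t : ℝ) (x : E) :
    linearFlow (1 : E →L[ℝ] E) t x = Real.exp t • x := by
  have h := NormedSpace.algebraMap_exp_comm (𝕂 := ℝ) (𝔸 := E →L[ℝ] E) t
  rw [Algebra.algebraMap_eq_smul_one, Algebra.algebraMap_eq_smul_one, ← Real.exp_eq_exp_ℝ] at h
  rw [linearFlow, ← h]
  simp

/-- The second derivative at `t = 0` of `e^{c t} (h (exp (t A) x) - h x)`. -/
noncomputable def flowSecondDeriv (A : E →L[ℝ] E) (c : ℝ) (h : E → ℝ) (x : E) : ℝ :=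
  2 * c * fderiv ℝ h x (A x) + fderiv ℝ (fderiv ℝ h) x (A x) (A x) + fderiv ℝ h x (A (A x))

variable [CompleteSpace E]

theorem hasDerivAt_linearFlow (A : E →L[ℝ] E) (t : ℝ) (x : E) :
    HasDerivAt (fun t => linearFlow A t x) (A (linearFlow A t x)) t := by
  have h := hasDerivAt_exp_smul_const' (𝕂 := ℝ) A t
  exact ((ContinuousLinearMap.apply ℝ E x).hasFDerivAt.comp_hasDerivAt t h)

theorem linearFlow_neg_apply (A : E →L[ℝ] E) (t : ℝ) (x : E) :
    linearFlow A (-t) (linearFlow A t x) = x := by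
  have h : linearFlow A (-t) * linearFlow A t = 1 := by
    let : NormedAlgebra ℚ (E →L[ℝ] E) := NormedAlgebra.restrictScalars ℚ ℝ _
    rw [linearFlow, linearFlow, ← NormedSpace.exp_add_of_commute, ← add_smul]
    · simp
    · exact ((Commute.refl A).smul_left _).smul_right _
  exact DFunLike.congr_fun h x

theorem continuous_linearFlow (A : E →L[ℝ] E) :
    Continuous fun z : ℝ × E => linearFlow A z.1 z.2 := by
  have h : Continuous (linearFlow A) := by
    rw [continuous_iff_continuousAt]
    exact fun t => (hasDerivAt_exp_smul_const' (𝕂 := ℝ) A t).continuousAt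
  exact (h.comp continuous_fst).clm_apply continuous_snd

/-- Subtracting `h x` before multiplying by `e^{ct}` removes the zeroth-order term `c² h` from the
second derivative and makes the value at `t = 0` vanish. -/
theorem tendsto_integral_flow [MeasurableSpace E] [BorelSpace E] {μ : Measure E}
    (A : E →L[ℝ] E) (c : ℝ) {h : E → ℝ} (hh : ContDiff ℝ ∞ h) (hsupp : HasCompactSupport h)
    (h0 : (0 : E) ∉ tsupport h) {w : E → ℝ} (hwm : AEStronglyMeasurable w μ)
    (hw : ∀ K : Set E, IsCompact K → (0 : E) ∉ K → IntegrableOn w K μ) :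
    Tendsto (fun t => ∫ x, w x * ((Real.exp (c * t) * (h (linearFlow A t x) - h x) +
        Real.exp (-(c * t)) * (h (linearFlow A (-t) x) - h x)) / t ^ 2) ∂μ) (𝓝[>] 0)
      (𝓝 (∫ x, w x * flowSecondDeriv A c h x ∂μ)) := by
  -- `K` contains the supports of all translates for `|t| ≤ 1`. It misses the origin because the
  -- flow is invertible and fixes `0`.
  set K : Set E := (fun z : ℝ × E => linearFlow A z.1 z.2) '' (Icc (-1 : ℝ) 1 ×ˢ tsupport h) with hKd
  have hK : IsCompact K := (isCompact_Icc.prod hsupp).image (continuous_linearFlow A)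
  have hK0 : (0 : E) ∉ K := by
    rintro ⟨⟨t, y⟩, ⟨-, hy⟩, e⟩
    have := linearFlow_neg_apply A t y
    simp only at e hy
    rw [e, map_zero] at this
    exact h0 (this ▸ hy)
  have hnot : ∀ t ∈ Icc (-1 : ℝ) 1, ∀ x ∉ K, linearFlow A t x ∉ tsupport h := fun t ht x hx hmem =>
    hx ⟨(-t, linearFlow A t x), ⟨⟨by linarith [ht.2], by linarith [ht.1]⟩, hmem⟩,
      linearFlow_neg_apply A t x⟩
  have hd1 : Differentiable ℝ h := hh.differentiable (by simp)
  have hh1 : ContDiff ℝ ∞ (fderiv ℝ h) := hh.fderiv_right (m := ∞) (by simp)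
  have hd2 : Differentiable ℝ (fderiv ℝ h) := hh1.differentiable (by simp)
  have hc1 : Continuous (fderiv ℝ h) := hh1.continuous
  have hc2 : Continuous (fderiv ℝ (fderiv ℝ h)) := (hh1.fderiv_right (m := ∞) (by simp)).continuous
  have hc0 : Continuous h := hh.continuous
  have hfl := continuous_linearFlow A
  have hg : ∀ t x, HasDerivAt (fun t => h (linearFlow A t x))
      (fderiv ℝ h (linearFlow A t x) (A (linearFlow A t x))) t := fun t x =>
    (hd1 _).hasFDerivAt.comp_hasDerivAt t (hasDerivAt_linearFlow A t x)
  have hg' : ∀ t x, HasDerivAt (fun t => fderiv ℝ h (linearFlow A t x) (A (linearFlow A t x)))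
      (fderiv ℝ (fderiv ℝ h) (linearFlow A t x) (A (linearFlow A t x)) (A (linearFlow A t x)) +
        fderiv ℝ h (linearFlow A t x) (A (A (linearFlow A t x)))) t := fun t x =>
    ((hd2 _).hasFDerivAt.comp_hasDerivAt t (hasDerivAt_linearFlow A t x)).clm_apply
      (A.hasFDerivAt.comp_hasDerivAt t (hasDerivAt_linearFlow A t x))
  have hexp : ∀ t, HasDerivAt (fun t => Real.exp (c * t)) (Real.exp (c * t) * c) t := fun t => by
    simpa using ((hasDerivAt_id t).const_mul c).exp
  have key := tendsto_integral_mul_second_difference (μ := μ)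
    (G := fun t x => Real.exp (c * t) * (h (linearFlow A t x) - h x))
    (G' := fun t x => Real.exp (c * t) * c * (h (linearFlow A t x) - h x) +
      Real.exp (c * t) * fderiv ℝ h (linearFlow A t x) (A (linearFlow A t x)))
    (G'' := fun t x => (Real.exp (c * t) * c * c * (h (linearFlow A t x) - h x) +
      Real.exp (c * t) * c * fderiv ℝ h (linearFlow A t x) (A (linearFlow A t x))) +
      (Real.exp (c * t) * c * fderiv ℝ h (linearFlow A t x) (A (linearFlow A t x)) +
      Real.exp (c * t) *
        (fderiv ℝ (fderiv ℝ h) (linearFlow A t x) (A (linearFlow A t x)) (A (linearFlow A t x)) +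
        fderiv ℝ h (linearFlow A t x) (A (A (linearFlow A t x))))))
    (fun t x => (hexp t).mul ((hg t x).sub_const _))
    (fun t x => (((hexp t).mul_const c).mul ((hg t x).sub_const _)).add ((hexp t).mul (hg' t x)))
    (fun t => ?_) ?_ hK (fun t ht x hx => ?_) hwm (hw K hK hK0)
  · refine (key.congr fun t => ?_).trans_eq ?_
    · refine integral_congr_ae (.of_forall fun x => ?_)
      simp [linearFlow_zero]
    · congr 1
      refine integral_congr_ae (.of_forall fun x => ?_)
      simp only [linearFlow_zero, flowSecondDeriv, mul_zero, Real.exp_zero]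
      ring
  · have h3 : Continuous fun x => linearFlow A t x := (linearFlow A t).continuous
    exact Continuous.measurable (by fun_prop)
  · unfold Function.uncurry
    fun_prop
  · have hx1 := hnot t ht x hx
    have hx0 : h x = 0 := by
      have := hnot 0 (by simp) x hx
      rw [linearFlow_zero] at this
      exact image_eq_zero_of_notMem_tsupport this
    have e0 := image_eq_zero_of_notMem_tsupport hx1
    have e1 : fderiv ℝ h (linearFlow A t x) = 0 :=
      image_eq_zero_of_notMem_tsupport fun hm => hx1 (tsupport_fderiv_subset ℝ hm)
    have e2 : fderiv ℝ (fderiv ℝ h) (linearFlow A t x) = 0 :=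
      image_eq_zero_of_notMem_tsupport fun hm => hx1
        (tsupport_fderiv_subset ℝ (tsupport_fderiv_subset ℝ hm))
    simp [e0, e1, e2, hx0]

end LinearFlow

/-! ### Rotations and the decomposition of `|x|²Δ`. -/

/-- The infinitesimal rotation `x ↦ x_i e_j - x_j e_i`. -/
noncomputable def rotationGenerator {n : ℕ} (i j : Fin n) :
    EuclideanSpace ℝ (Fin n) →L[ℝ] EuclideanSpace ℝ (Fin n) :=
  (EuclideanSpace.proj i : EuclideanSpace ℝ (Fin n) →L[ℝ] ℝ).smulRight
      (EuclideanSpace.basisFun (Fin n) ℝ j) -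
    (EuclideanSpace.proj j : EuclideanSpace ℝ (Fin n) →L[ℝ] ℝ).smulRight
      (EuclideanSpace.basisFun (Fin n) ℝ i)

theorem rotationGenerator_apply {n : ℕ} (i j : Fin n) (x : EuclideanSpace ℝ (Fin n)) :
    rotationGenerator i j x = x i • EuclideanSpace.basisFun (Fin n) ℝ j -
      x j • EuclideanSpace.basisFun (Fin n) ℝ i := rfl

theorem inner_rotationGenerator_self {n : ℕ} (i j : Fin n) (x : EuclideanSpace ℝ (Fin n)) :
    inner ℝ x (rotationGenerator i j x) = 0 := by
  rw [rotationGenerator_apply, inner_sub_right, inner_smul_right, inner_smul_right]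
  simp [EuclideanSpace.basisFun_apply, EuclideanSpace.inner_single_right]
  ring

/-- The square of a generator is minus the projection onto its coordinate plane, and these sum to
`-(n-1)x` over the planes. Ordered pairs count each plane twice, hence the factors 2. -/
theorem sum_rotationGenerator {n : ℕ} (x : EuclideanSpace ℝ (Fin n))
    (D : EuclideanSpace ℝ (Fin n) →L[ℝ] ℝ)
    (B : EuclideanSpace ℝ (Fin n) →L[ℝ] EuclideanSpace ℝ (Fin n) →L[ℝ] ℝ) :
    ∑ i, ∑ j, (B (rotationGenerator i j x) (rotationGenerator i j x) +
        D (rotationGenerator i j (rotationGenerator i j x))) =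
      2 * (‖x‖ ^ 2 * ∑ i, B (EuclideanSpace.basisFun (Fin n) ℝ i)
        (EuclideanSpace.basisFun (Fin n) ℝ i) - B x x) - 2 * ((n : ℝ) - 1) * D x := by
  obtain ⟨e, he⟩ : ∃ e : Fin n → EuclideanSpace ℝ (Fin n),
    e = fun i => EuclideanSpace.basisFun (Fin n) ℝ i := ⟨_, rfl⟩
  have hx : x = ∑ i, x i • e i := by
    conv_lhs => rw [← (EuclideanSpace.basisFun (Fin n) ℝ).sum_repr x]
    simp [he]
  have hA : ∀ i j y, rotationGenerator i j y = y i • e j - y j • e i := fun i j y => by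
    rw [he]; rfl
  have hee : ∀ i j, e j i = if i = j then 1 else 0 := fun i j => by
    simp [he]
  have hN : ‖x‖ ^ 2 = ∑ i, x i * x i := by
    rw [EuclideanSpace.norm_sq_eq]
    exact Finset.sum_congr rfl fun i _ => by rw [Real.norm_eq_abs, sq_abs, sq]
  have hB : B x x = ∑ i, ∑ j, x i * x j * B (e i) (e j) := by
    conv_lhs => rw [hx]
    simp only [map_sum, map_smul, sum_apply, smul_apply,
      smul_eq_mul, Finset.mul_sum]
    rw [Finset.sum_comm]
    exact Finset.sum_congr rfl fun i _ => Finset.sum_congr rfl fun j _ => by ring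
  have hB' : B x x = ∑ i, ∑ j, x i * x j * B (e j) (e i) := by
    rw [hB, Finset.sum_comm]
    exact Finset.sum_congr rfl fun i _ => Finset.sum_congr rfl fun j _ => by ring
  have hD : D x = ∑ i, x i * D (e i) := by
    conv_lhs => rw [hx]
    simp [map_sum]
  -- The `if` term corrects the diagonal, where the generator is zero.
  have h1 : ∀ i j, B (rotationGenerator i j x) (rotationGenerator i j x) +
      D (rotationGenerator i j (rotationGenerator i j x)) =
      x i * x i * B (e j) (e j) + x j * x j * B (e i) (e i) - x i * x j * B (e j) (e i) -
        x i * x j * B (e i) (e j) + (if i = j then x i * D (e j) + x j * D (e i) else 0) -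
        x j * D (e j) - x i * D (e i) := by
    intro i j
    have e1 : (rotationGenerator i j x) i = (if i = j then x i else 0) - x j := by
      rw [hA]; simp [hee]
    have e2 : (rotationGenerator i j x) j = x i - (if i = j then x j else 0) := by
      rw [hA]; simp [hee, eq_comm]
    rw [hA i j (rotationGenerator i j x), e1, e2, hA]
    simp only [map_sub, map_smul, sub_apply, smul_apply,
      smul_eq_mul]
    split_ifs <;> ring
  simp only [h1, Finset.sum_sub_distrib, Finset.sum_add_distrib, Finset.sum_ite_eq,
    Finset.mem_univ, if_true, ← hB, ← hB', ← hD, Finset.sum_const, Finset.card_univ,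
    Fintype.card_fin, nsmul_eq_mul]
  have h2 : ∑ i, ∑ j, x i * x i * B (e j) (e j) = ‖x‖ ^ 2 * ∑ i, B (e i) (e i) := by
    rw [hN, Finset.sum_mul_sum]
  have h3 : ∑ i, ∑ j, x j * x j * B (e i) (e i) = ‖x‖ ^ 2 * ∑ i, B (e i) (e i) := by
    rw [Finset.sum_comm, h2]
  have h4 : ∀ i, (EuclideanSpace.basisFun (Fin n) ℝ) i = e i := fun i => by rw [he]
  simp only [h4]
  rw [h2, h3, ← Finset.mul_sum, ← hD]
  ring

/-- `|x|² Δh` is the sum of the second derivatives of `h` along the dilation flow and along the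
rotations in the coordinate planes. -/
theorem norm_sq_mul_laplacian {n : ℕ} (h : EuclideanSpace ℝ (Fin n) → ℝ)
    (x : EuclideanSpace ℝ (Fin n)) :
    ‖x‖ ^ 2 * Laplacian.laplacian h x =
      flowSecondDeriv (1 : EuclideanSpace ℝ (Fin n) →L[ℝ] EuclideanSpace ℝ (Fin n))
        (((n : ℝ) - 2) / 2) h x +
      (∑ i, ∑ j, flowSecondDeriv (rotationGenerator i j) 0 h x) / 2 := by
  have h1 := sum_rotationGenerator x (fderiv ℝ h x) (fderiv ℝ (fderiv ℝ h) x)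
  simp only [flowSecondDeriv, mul_zero, zero_mul, zero_add, one_apply_eq_self]
  rw [h1, InnerProductSpace.laplacian_eq_iteratedFDeriv_orthonormalBasis h
    (EuclideanSpace.basisFun (Fin n) ℝ)]
  simp only [iteratedFDeriv_two_apply, Matrix.cons_val_zero, Matrix.cons_val_one]
  ring

section SkewFlow

variable {E : Type*} [NormedAddCommGroup E] [InnerProductSpace ℝ E] [FiniteDimensional ℝ E]

/-- The derivative of `|y|²` along the flow is `2⟨y, A y⟩ = 0`. -/
theorem norm_linearFlow_of_skew {A : E →L[ℝ] E} (hA : ∀ x, inner ℝ x (A x) = 0) (t : ℝ) (x : E) :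
    ‖linearFlow A t x‖ = ‖x‖ := by
  have hd : ∀ t, HasDerivAt (fun t => ‖linearFlow A t x‖ ^ 2) 0 t := fun t => by
    simpa [hA] using (hasDerivAt_linearFlow A t x).norm_sq
  have h := is_const_of_deriv_eq_zero (fun t => (hd t).differentiableAt) (fun t => (hd t).deriv) t 0
  rw [linearFlow_zero] at h
  exact (sq_eq_sq₀ (norm_nonneg _) (norm_nonneg _)).1 h

theorem exists_linearIsometryEquiv_linearFlow {A : E →L[ℝ] E} (hA : ∀ x, inner ℝ x (A x) = 0)
    (t : ℝ) : ∃ e : E ≃ₗᵢ[ℝ] E, ∀ x, e x = linearFlow A t x :=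
  ⟨LinearIsometry.toLinearIsometryEquiv
    ⟨(linearFlow A t).toLinearMap, fun x => norm_linearFlow_of_skew hA t x⟩ rfl, fun _ => rfl⟩

variable [MeasurableSpace E] [BorelSpace E]

theorem integral_comp_linearFlow_sub_eq_zero {A : E →L[ℝ] E} (hA : ∀ x, inner ℝ x (A x) = 0)
    (t : ℝ) {f : E → ℝ} (hf : Integrable f) :
    Integrable (fun x => f (linearFlow A t x) - f x) ∧
      ∫ x, (f (linearFlow A t x) - f x) = 0 := by
  obtain ⟨e, he⟩ := exists_linearIsometryEquiv_linearFlow hA t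
  simp only [← he]
  have hi : Integrable (fun x => f (e x)) := e.measurePreserving.integrable_comp_of_integrable hf
  refine ⟨hi.sub hf, ?_⟩
  rw [integral_sub hi hf, e.measurePreserving.integral_comp
    e.toHomeomorph.measurableEmbedding, sub_self]

end SkewFlow

/-! ### Rotations and dilations against the weight `v(|x|)/|x|²`. -/

section RadialWeight

variable {n : ℕ} {p : ℝ} {v : ℝ → ℝ}

theorem measurable_radial_div_sq (hv : Measurable v) :
    Measurable fun x : EuclideanSpace ℝ (Fin n) => v ‖x‖ / ‖x‖ ^ 2 :=
  (hv.comp measurable_norm).div (measurable_norm.pow_const 2)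

theorem integrableOn_radial_div_sq
    (hint : Integrable (fun x : EuclideanSpace ℝ (Fin n) => v ‖x‖ * (1 + ‖x‖) ^ (-p)))
    {K : Set (EuclideanSpace ℝ (Fin n))} (hK : IsCompact K) (hK0 : 0 ∉ K) :
    IntegrableOn (fun x => v ‖x‖ / ‖x‖ ^ 2) K := by
  have h1 := hint.integrableOn (s := K)
  have h2 : ContinuousOn (fun x : EuclideanSpace ℝ (Fin n) => (1 + ‖x‖) ^ p / ‖x‖ ^ 2) K := by
    refine ContinuousOn.div (ContinuousOn.rpow_const (by fun_prop) fun x _ => Or.inl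
      (by positivity)) (by fun_prop) fun x hx => ?_
    have : x ≠ 0 := fun h => hK0 (h ▸ hx)
    exact pow_ne_zero 2 (norm_ne_zero_iff.2 this)
  refine (h1.mul_continuousOn h2 hK).congr_fun (fun x _ => ?_) hK.measurableSet
  simp only
  rw [Real.rpow_neg (by positivity)]
  have : 0 < (1 + ‖x‖) ^ p := by positivity
  field_simp

theorem integrable_mul_of_forall_integrableOn {w : EuclideanSpace ℝ (Fin n) → ℝ}
    (hw : ∀ K, IsCompact K → 0 ∉ K → IntegrableOn w K)
    {k : EuclideanSpace ℝ (Fin n) → ℝ} (hk : Continuous k) (hsupp : HasCompactSupport k)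
    (hk0 : 0 ∉ tsupport k) : Integrable fun x => w x * k x := by
  have h1 := (hw _ hsupp hk0).mul_continuousOn hk.continuousOn hsupp
  rwa [integrableOn_iff_integrable_of_support_subset] at h1
  exact fun x hx => subset_tsupport k (right_ne_zero_of_mul hx)

/-- Rotations preserve both the radial weight and the volume, so each difference quotient already
integrates to zero. -/
theorem integral_mul_flowSecondDeriv_rotation (hv : Measurable v)
    (hint : Integrable (fun x : EuclideanSpace ℝ (Fin n) => v ‖x‖ * (1 + ‖x‖) ^ (-p)))
    {h : EuclideanSpace ℝ (Fin n) → ℝ} (hh : IsTestFunctionOn {0}ᶜ h) (i j : Fin n) :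
    ∫ x, v ‖x‖ / ‖x‖ ^ 2 * flowSecondDeriv (rotationGenerator i j) 0 h x = 0 := by
  have h0 : (0 : EuclideanSpace ℝ (Fin n)) ∉ tsupport h := fun h0 => hh.tsupport_subset h0 rfl
  have hw := fun K => integrableOn_radial_div_sq (K := K) hint
  have hlim := tendsto_integral_flow (μ := volume) (rotationGenerator i j) 0 hh.contDiff
    hh.hasCompactSupport h0 (w := fun x => v ‖x‖ / ‖x‖ ^ 2)
    (measurable_radial_div_sq hv).aestronglyMeasurable hw
  refine tendsto_nhds_unique hlim (tendsto_nhds_of_eventually_eq (.of_forall fun t => ?_))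
  have hi := integrable_mul_of_forall_integrableOn hw hh.contDiff.continuous
    hh.hasCompactSupport h0
  have hA := fun x => inner_rotationGenerator_self i j x
  have h1 := integral_comp_linearFlow_sub_eq_zero hA t hi
  have h2 := integral_comp_linearFlow_sub_eq_zero hA (-t) hi
  have h3 := integral_add h1.1 h2.1
  rw [h1.2, h2.2, add_zero] at h3
  refine Eq.trans ?_ ((integral_const_mul (t ^ 2)⁻¹ _).trans ((congrArg _ h3).trans (mul_zero _)))
  refine integral_congr_ae (.of_forall fun x => ?_)
  simp only [norm_linearFlow_of_skew hA, zero_mul, neg_zero, Real.exp_zero]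
  ring

/-- Transfer of a dilation from the test function to the radial profile. -/
theorem integral_radial_div_sq_mul_comp_smul
    (hint : Integrable (fun x : EuclideanSpace ℝ (Fin n) => v ‖x‖ * (1 + ‖x‖) ^ (-p)))
    {h : EuclideanSpace ℝ (Fin n) → ℝ} (hh : IsTestFunctionOn {0}ᶜ h) {a : ℝ} (ha : 0 < a) :
    Integrable (fun x => v ‖x‖ / ‖x‖ ^ 2 * h (a • x)) ∧
    Integrable (fun x => v (‖x‖ / a) / ‖x‖ ^ 2 * h x) ∧
      ∫ x, v ‖x‖ / ‖x‖ ^ 2 * h (a • x) =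
        a ^ (2 - (n : ℝ)) * ∫ x, v (‖x‖ / a) / ‖x‖ ^ 2 * h x := by
  have h0 : (0 : EuclideanSpace ℝ (Fin n)) ∉ tsupport h := fun h0 => hh.tsupport_subset h0 rfl
  have hc := hh.contDiff.continuous
  have hi : Integrable (fun x => v ‖x‖ / ‖x‖ ^ 2 * h (a • x)) := by
    refine integrable_mul_of_forall_integrableOn
      (fun K => integrableOn_radial_div_sq (K := K) hint) (k := fun x => h (a • x))
      (by fun_prop) (hh.hasCompactSupport.comp_smul ha.ne') fun hmem => ?_
    have := tsupport_comp_subset_preimage h (continuous_const_smul a) hmem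
    rw [mem_preimage, smul_zero] at this
    exact h0 this
  have e1 : (fun x => v ‖x‖ / ‖x‖ ^ 2 * h (a • x)) =
      fun x => (fun y => a ^ 2 * (v (‖y‖ / a) / ‖y‖ ^ 2 * h y)) (a • x) := by
    ext x
    simp only [norm_smul, Real.norm_of_nonneg ha.le, mul_div_cancel_left₀ _ ha.ne']
    field_simp
  have hi' := hi
  rw [e1, integrable_comp_smul_iff volume (fun y => a ^ 2 * (v (‖y‖ / a) / ‖y‖ ^ 2 * h y))
    ha.ne'] at hi'
  refine ⟨hi, ?_, ?_⟩
  · refine (hi'.const_mul (a ^ 2)⁻¹).congr (.of_forall fun x => ?_)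
    simp only
    field_simp
  · rw [e1, Measure.integral_comp_smul volume (fun y => a ^ 2 * (v (‖y‖ / a) / ‖y‖ ^ 2 * h y)),
      integral_const_mul, finrank_euclideanSpace_fin,
      abs_of_pos (by positivity), smul_eq_mul, ← mul_assoc]
    congr 1
    rw [Real.rpow_sub ha, Real.rpow_natCast, Real.rpow_ofNat]
    field_simp

/-- Once the dilations are moved onto the profile, the integrand is a nonnegative multiple of minus
the left side of the hypothesis at `τ = e^t`, for every `t > 0`; the sign survives `t → 0`. -/
theorem integral_mul_flowSecondDeriv_dilation_nonneg (hv : Measurable v)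
    (hint : Integrable (fun x : EuclideanSpace ℝ (Fin n) => v ‖x‖ * (1 + ‖x‖) ^ (-p)))
    (hineq : ∀ r : ℝ, 0 < r → ∀ τ : ℝ, 1 ≤ τ →
      v r - v (r * τ) + (v r - v (r / τ)) * τ ^ (-(n : ℝ) + 2 * 1) ≤ 0)
    {h : EuclideanSpace ℝ (Fin n) → ℝ} (hh : IsTestFunctionOn {0}ᶜ h) (hh0 : ∀ x, 0 ≤ h x) :
    0 ≤ ∫ x, v ‖x‖ / ‖x‖ ^ 2 *
      flowSecondDeriv (1 : EuclideanSpace ℝ (Fin n) →L[ℝ] EuclideanSpace ℝ (Fin n))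
        (((n : ℝ) - 2) / 2) h x := by
  have h0 : (0 : EuclideanSpace ℝ (Fin n)) ∉ tsupport h := fun h0 => hh.tsupport_subset h0 rfl
  have hw := fun K => integrableOn_radial_div_sq (K := K) hint
  set c : ℝ := ((n : ℝ) - 2) / 2 with hc
  have hlim := tendsto_integral_flow (μ := volume)
    (1 : EuclideanSpace ℝ (Fin n) →L[ℝ] EuclideanSpace ℝ (Fin n)) c hh.contDiff
    hh.hasCompactSupport h0 (w := fun x => v ‖x‖ / ‖x‖ ^ 2)
    (measurable_radial_div_sq hv).aestronglyMeasurable hw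
  refine ge_of_tendsto hlim ?_
  filter_upwards [self_mem_nhdsWithin] with t ht
  have ht : 0 < t := ht
  have hi := integrable_mul_of_forall_integrableOn hw hh.contDiff.continuous
    hh.hasCompactSupport h0
  obtain ⟨i1, i1', e1⟩ := integral_radial_div_sq_mul_comp_smul hint hh (Real.exp_pos t)
  obtain ⟨i2, i2', e2⟩ := integral_radial_div_sq_mul_comp_smul hint hh (Real.exp_pos (-t))
  -- The choice `c = (n-2)/2` makes the factor `a^{2-n}` from the change of variables swap `e^{ct}`
  -- and `e^{-ct}`.
  have p1 : Real.exp (c * t) * Real.exp t ^ (2 - (n : ℝ)) = Real.exp (-(c * t)) := by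
    rw [← Real.exp_mul, ← Real.exp_add]; congr 1; rw [hc]; ring
  have p2 : Real.exp (-(c * t)) * Real.exp (-t) ^ (2 - (n : ℝ)) = Real.exp (c * t) := by
    rw [← Real.exp_mul, ← Real.exp_add]; congr 1; rw [hc]; ring
  have hlin : ∀ (α β γ : ℝ) {f g k : EuclideanSpace ℝ (Fin n) → ℝ}, Integrable f → Integrable g →
      Integrable k → ∫ x, (α * f x + β * g x - γ * k x) =
        α * (∫ x, f x) + β * (∫ x, g x) - γ * ∫ x, k x := fun α β γ f g k hf hg hk => by
    have hfg : Integrable fun x => α * f x + β * g x := (hf.const_mul α).add (hg.const_mul β)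
    rw [integral_sub hfg (hk.const_mul γ), integral_add (hf.const_mul α) (hg.const_mul β),
      integral_const_mul, integral_const_mul, integral_const_mul]
  have key : ∫ x, v ‖x‖ / ‖x‖ ^ 2 * ((Real.exp (c * t) *
      (h (linearFlow (1 : EuclideanSpace ℝ (Fin n) →L[ℝ] EuclideanSpace ℝ (Fin n)) t x) - h x) +
      Real.exp (-(c * t)) * (h (linearFlow (1 : EuclideanSpace ℝ (Fin n) →L[ℝ]
        EuclideanSpace ℝ (Fin n)) (-t) x) - h x)) / t ^ 2) =
      (t ^ 2)⁻¹ * ∫ x, (Real.exp (-(c * t)) * (v (‖x‖ / Real.exp t) / ‖x‖ ^ 2 * h x) +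
        Real.exp (c * t) * (v (‖x‖ / Real.exp (-t)) / ‖x‖ ^ 2 * h x) -
        (Real.exp (c * t) + Real.exp (-(c * t))) * (v ‖x‖ / ‖x‖ ^ 2 * h x)) := by
    rw [hlin _ _ _ i1' i2' hi]
    have e3 := hlin (Real.exp (c * t)) (Real.exp (-(c * t)))
      (Real.exp (c * t) + Real.exp (-(c * t))) i1 i2 hi
    rw [e1, e2, ← mul_assoc, ← mul_assoc, p1, p2] at e3
    rw [← e3, ← integral_const_mul]
    refine integral_congr_ae (.of_forall fun x => ?_)
    simp only [linearFlow_one]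
    ring
  rw [key]
  refine mul_nonneg (by positivity) (integral_nonneg fun x => ?_)
  -- At the origin the weights are zero by the convention for division by zero.
  rcases eq_or_ne x 0 with rfl | hx
  · simp
  have hx' : 0 < ‖x‖ := norm_pos_iff.2 hx
  have h1 := hineq ‖x‖ hx' (Real.exp t) (Real.one_le_exp ht.le)
  have p3 : Real.exp (c * t) * Real.exp t ^ (-(n : ℝ) + 2 * 1) = Real.exp (-(c * t)) := by
    rw [← p1]; congr 2; ring
  have h2 := mul_nonpos_of_nonneg_of_nonpos (Real.exp_pos (c * t)).le h1
  rw [mul_add, mul_left_comm, p3] at h2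
  rw [Real.exp_neg t, div_inv_eq_mul]
  have h3 : 0 ≤ h x / ‖x‖ ^ 2 := div_nonneg (hh0 x) (by positivity)
  have h4 := mul_nonneg (neg_nonneg.2 h2) h3
  refine h4.trans_eq ?_
  ring

end RadialWeight

/-! ### Conclusion for `s = 1` and the main theorem. -/

theorem fracLaplacian_pairing_one {n : ℕ} (hn : 1 ≤ n) {v : ℝ → ℝ} (hv : Measurable v)
    (hint : Integrable (fun x : EuclideanSpace ℝ (Fin n) =>
      v ‖x‖ * (1 + ‖x‖) ^ (-((n : ℝ) + 2 * 1))))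
    (hineq : ∀ r : ℝ, 0 < r → ∀ τ : ℝ, 1 ≤ τ →
      v r - v (r * τ) + (v r - v (r / τ)) * τ ^ (-(n : ℝ) + 2 * 1) ≤ 0)
    {h : EuclideanSpace ℝ (Fin n) → ℝ} (hh : IsTestFunctionOn {0}ᶜ h) (h0 : ∀ x, 0 ≤ h x) :
    Integrable (fun x => v ‖x‖ * fracLaplacian 1 h x) ∧
      ∫ x, v ‖x‖ * fracLaplacian 1 h x ≤ 0 := by
  have : Nonempty (Fin n) := ⟨⟨0, hn⟩⟩
  have h0t : (0 : EuclideanSpace ℝ (Fin n)) ∉ tsupport h := fun h0 => hh.tsupport_subset h0 rfl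
  have hw := fun K => integrableOn_radial_div_sq (K := K) hint
  have hh1 : ContDiff ℝ ∞ (fderiv ℝ h) := hh.contDiff.fderiv_right (m := ∞) (by simp)
  have hc1 : Continuous (fderiv ℝ h) := hh1.continuous
  have hc2 : Continuous (fderiv ℝ (fderiv ℝ h)) :=
    (hh1.fderiv_right (m := ∞) (by simp)).continuous
  have hi : ∀ (A : EuclideanSpace ℝ (Fin n) →L[ℝ] EuclideanSpace ℝ (Fin n)) (c : ℝ),
      Integrable fun x => v ‖x‖ / ‖x‖ ^ 2 * flowSecondDeriv A c h x := fun A c => by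
    have hz : ∀ x ∉ tsupport h, flowSecondDeriv A c h x = 0 := fun x hx => by
      have e1 : fderiv ℝ h x = 0 :=
        image_eq_zero_of_notMem_tsupport fun hm => hx (tsupport_fderiv_subset ℝ hm)
      have e2 : fderiv ℝ (fderiv ℝ h) x = 0 :=
        image_eq_zero_of_notMem_tsupport fun hm => hx
          (tsupport_fderiv_subset ℝ (tsupport_fderiv_subset ℝ hm))
      simp [flowSecondDeriv, e1, e2]
    refine integrable_mul_of_forall_integrableOn hw ?_
      (HasCompactSupport.intro hh.hasCompactSupport hz) fun hm => h0t ?_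
    · unfold flowSecondDeriv
      fun_prop
    · refine closure_minimal (fun x hx => ?_) (isClosed_tsupport h) hm
      by_contra hx'
      exact hx (hz x hx')
  -- Away from the origin, `v Δh = (v/|x|²)(|x|²Δh)`, and the second factor splits along the flows.
  have hae : (fun x => v ‖x‖ * fracLaplacian 1 h x) =ᵐ[volume] fun x =>
      -(v ‖x‖ / ‖x‖ ^ 2 * flowSecondDeriv (1 : EuclideanSpace ℝ (Fin n) →L[ℝ] _)
          (((n : ℝ) - 2) / 2) h x +
        (∑ i, ∑ j, v ‖x‖ / ‖x‖ ^ 2 * flowSecondDeriv (rotationGenerator i j) 0 h x) / 2) := by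
    filter_upwards [compl_mem_ae_iff.2 (measure_singleton (0 : EuclideanSpace ℝ (Fin n)))] with x hx
    have hx' : 0 < ‖x‖ := norm_pos_iff.2 hx
    have h1 := norm_sq_mul_laplacian h x
    simp only [← Finset.mul_sum]
    rw [fracLaplacian, if_pos rfl, mul_div_assoc, ← mul_add, ← h1]
    field_simp
  have hs1 : ∀ i : Fin n, Integrable fun x =>
      ∑ j, v ‖x‖ / ‖x‖ ^ 2 * flowSecondDeriv (rotationGenerator i j) 0 h x := fun i =>
    integrable_finsetSum _ fun j _ => hi _ _
  have hs2 : Integrable fun x =>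
      ∑ i, ∑ j, v ‖x‖ / ‖x‖ ^ 2 * flowSecondDeriv (rotationGenerator i j) 0 h x :=
    integrable_finsetSum _ fun i _ => hs1 i
  refine ⟨(((hi _ _).add (hs2.div_const 2)).neg).congr hae.symm, ?_⟩
  rw [integral_congr_ae hae, integral_neg, integral_add (hi _ _) (hs2.div_const 2), integral_div,
    integral_finsetSum _ fun i _ => hs1 i]
  have hrot : ∀ i : Fin n, ∫ x, ∑ j, v ‖x‖ / ‖x‖ ^ 2 *
      flowSecondDeriv (rotationGenerator i j) 0 h x = 0 := fun i => by
    rw [integral_finsetSum _ fun j _ => hi _ _]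
    exact Finset.sum_eq_zero fun j _ => integral_mul_flowSecondDeriv_rotation hv hint hh i j
  simp only [hrot, Finset.sum_const_zero, zero_div, add_zero]
  linarith [integral_mul_flowSecondDeriv_dilation_nonneg hv hint hineq hh h0]

theorem theorem1p2 (n : ℕ) (hn : 2 ≤ n) (s : ℝ) (hs : s ∈ Set.Ioc (0 : ℝ) 1) (u : ℝ → EReal)
    (hu_lt_top : ∀ r : ℝ, 0 < r → u r < ⊤)
    (hu_usc : UpperSemicontinuousOn u (Set.Ioi 0))
    (hu_int : ∫⁻ r in Set.Ioi (0 : ℝ),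
      (u r).abs * ENNReal.ofReal (r ^ (n - 1) / (1 + r) ^ ((n : ℝ) + 2 * s)) < ⊤)
    (hu : ∀ r : ℝ, 0 < r → ∀ τ : ℝ, 1 ≤ τ →
      u r - u (r * τ) + (u r - u (r / τ)) * ((τ ^ (-(n : ℝ) + 2 * s) : ℝ) : EReal) ≤ 0) :
    IsSSubharmonicOn s (fun x : EuclideanSpace ℝ (Fin n) => u ‖x‖) {0}ᶜ := by
  obtain ⟨v, hv, huv⟩ := exists_real_profile hu_lt_top hu_usc hu_int hu
  have : Nonempty (Fin n) := ⟨⟨0, by omega⟩⟩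
  have hint : Integrable (fun x : EuclideanSpace ℝ (Fin n) =>
      v ‖x‖ * (1 + ‖x‖) ^ (-((n : ℝ) + 2 * s))) := by
    refine integrable_radial_mul_one_add_norm (by omega) hv ?_
    rwa [setLIntegral_congr_fun measurableSet_Ioi
      (fun r hr => by rw [huv r hr])] at hu_int
  have hineq : ∀ r : ℝ, 0 < r → ∀ τ : ℝ, 1 ≤ τ →
      v r - v (r * τ) + (v r - v (r / τ)) * τ ^ (-(n : ℝ) + 2 * s) ≤ 0 := by
    intro r hr τ hτ
    have := hu r hr τ hτ
    rw [huv r hr, huv (r * τ) (by positivity), huv (r / τ) (by positivity)] at this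
    exact_mod_cast this
  refine ⟨hasWeightedIntegrability_of_integrable (by omega) hs.1 hv huv hint,
    fun x hx => hu_lt_top _ (norm_pos_iff.2 hx), ?_, ?_⟩
  · exact hu_usc.comp continuous_norm.continuousOn fun x hx => norm_pos_iff.2 hx
  · intro h hh h0
    have hmain : Integrable (fun x : EuclideanSpace ℝ (Fin n) => v ‖x‖ * fracLaplacian s h x) ∧
        ∫ x, v ‖x‖ * fracLaplacian s h x ≤ 0 := by
      rcases hs.2.lt_or_eq with hs1 | rfl
      · exact fracLaplacian_pairing_of_lt_one (by omega) hs.1 hs1 hv hint hineq hh h0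
      · exact fracLaplacian_pairing_one (by omega) hv hint hineq hh h0
    have hae : (fun x : EuclideanSpace ℝ (Fin n) => (u ‖x‖).toReal * fracLaplacian s h x) =ᵐ[volume]
        fun x => v ‖x‖ * fracLaplacian s h x := by
      filter_upwards [compl_mem_ae_iff.2 (measure_singleton (0 : EuclideanSpace ℝ (Fin n)))]
        with x hx
      rw [huv _ (norm_pos_iff.2 hx), EReal.toReal_coe]
    refine ⟨hmain.1.congr hae.symm, ?_⟩
    rw [fracLaplacianPairing, integral_congr_ae hae]
    linarith [hmain.2]
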